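/- **Theorem (Reducible variance).** Let $K>1$ be an integer, $\sigma>0$, $\theta\in\mathbb R^n$, and $Y\sim\mathcal N(\theta,\sigma^2 I_n)$. Let $\omega^{(1)},\dots,\omega^{(K)}$ be jointly Gaussian random vectors in $\mathbb R^n$, independent of $Y$, with $\omega^{(k)}\sim\mathcal N(0,\sigma^2I_n)$ and $\operatorname{Cov}(\omega^{(j)},\omega^{(k)})=-\frac{\sigma^2}{K-1}I_n$ for $j\neq k$. For a measurable function $g:\mathbb R^n\to\mathbb R^n$ and $\alpha>0$ put $$\mathrm{CV}_\alpha=\frac1K\sum_{k=1}^K\Big(\big\|Y-\tfrac1{\sqrt\alpha}\omega^{(k)}-g\big(Y+\sqrt\alpha\,\omega^{(k)}\big)\big\|_2^2-\tfrac1\alpha\|\omega^{(k)}\|_2^2\Big).$$ Assume that $g$ is weakly differentiable in the following sense: there is a measurable $\nabla g:\mathbb R^n\to\mathbb R^{n\times n}$ with rows $\nabla g_1,\dots,\nabla g_n$ such that, for every $i$ and almost all $(y,z)\in\mathbb R^n\times\mathbb R^n$, the function $t\mapsto z\cdot\nabla g_i(y+tz)$ is integrable on $[0,1]$ and $$g_i(y+z)-g_i(y)=\int_0^1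 z\cdot\nabla g_i(y+tz)\,dt.$$ Assume further that $\mathbb E\|g(Y)\|_2^4<\infty$, that $\mathbb E\|\nabla g(Y)\|_F^2<\infty$, and that $\mathbb E[\mathrm{CV}_{\alpha_0}^2]<\infty$ for at least one $\alpha_0>0$. Then $\mathbb E[\mathrm{CV}_\alpha^2]<\infty$ for all sufficiently small $\alpha>0$, and $$\lim_{\alpha\downarrow0}\mathbb E\big[\operatorname{Var}(\mathrm{CV}_\alpha\mid Y)\big]=\frac{4\sigma^4}{K-1}\,\mathbb E\big[\|\nabla g(Y)\|_F^2+\operatorname{tr}\big(\nabla g(Y)^2\big)\big].$$ In particular, for any fixed $K>1$, the reducible variance $\mathbb E[\operatorname{Var}(\mathrm{CV}_\alpha\mid Y)]$ stays bounded as $\alpha\downarrow0$. -/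

import Mathlib

open MeasureTheory ProbabilityTheory Filter Topology

noncomputable section

/-- `G` is a weak Jacobian of `g : ℝⁿ → ℝⁿ`: for every component `i`, the `i`-th row `∇gᵢ` of `G`
satisfies `gᵢ(y + z) - gᵢ(y) = ∫₀¹ z · ∇gᵢ(y + t z) dt` for almost all `(y, z) ∈ ℝⁿ × ℝⁿ`
(the integral being that of an integrable function). -/
structure HasWeakJacobian {n : ℕ} (g : EuclideanSpace ℝ (Fin n) → EuclideanSpace ℝ (Fin n))
    (G : EuclideanSpace ℝ (Fin n) → Matrix (Fin n) (Fin n) ℝ) : Prop where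
  aemeasurable : ∀ i j, AEMeasurable (fun y ↦ G y i j) volume
  ae_line_integral : ∀ i, ∀ᵐ p : EuclideanSpace ℝ (Fin n) × EuclideanSpace ℝ (Fin n),
    IntervalIntegrable (fun t : ℝ ↦ ∑ j, p.2 j * G (p.1 + t • p.2) i j) volume 0 1 ∧
    g (p.1 + p.2) i - g p.1 i = ∫ t in (0 : ℝ)..1, ∑ j, p.2 j * G (p.1 + t • p.2) i j

/-- The squared Frobenius norm `‖A‖_F²` of a matrix. -/
def frobeniusSq {n : ℕ} (A : Matrix (Fin n) (Fin n) ℝ) : ℝ := ∑ i, ∑ j, A i j ^ 2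

/-- The antithetic randomization scheme: `ω⁽¹⁾, …, ω⁽ᴷ⁾` are jointly Gaussian in `ℝⁿ`, each with
law `N(0, σ² Iₙ)`, and `Cov(ω⁽ʲ⁾, ω⁽ᵏ⁾) = -σ²/(K-1) Iₙ` for `j ≠ k`. -/
structure IsAntithetic {Ω : Type*} [MeasurableSpace Ω] {n K : ℕ} (σ : ℝ)
    (ω : Fin K → Ω → EuclideanSpace ℝ (Fin n)) (P : Measure Ω) : Prop where
  gaussian : HasGaussianLaw (fun w k ↦ ω k w) P
  hasLaw : ∀ k, HasLaw (ω k)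
    (multivariateGaussian 0 (σ ^ 2 • (1 : Matrix (Fin n) (Fin n) ℝ))) P
  cov : ∀ j k, j ≠ k → ∀ a b : Fin n,
    cov[fun w ↦ ω j w a, fun w ↦ ω k w b; P] =
      (-(σ ^ 2 / ((K : ℝ) - 1)) • (1 : Matrix (Fin n) (Fin n) ℝ)) a b

/-- The training copy `y + √α w` of the data `y` built from the randomization `w`. -/
def trainData {n : ℕ} (α : ℝ) (y w : EuclideanSpace ℝ (Fin n)) : EuclideanSpace ℝ (Fin n) :=
  y + √α • w

/-- The test copy `y - (1/√α) w` of the data `y` built from the randomization `w`. -/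
def testData {n : ℕ} (α : ℝ) (y w : EuclideanSpace ℝ (Fin n)) : EuclideanSpace ℝ (Fin n) :=
  y - (1 / √α) • w

/-- The cross-validated estimator
`CV_α = (1/K) ∑ₖ (‖Y_test⁽ᵏ⁾ - g(Y_train⁽ᵏ⁾)‖² - (1/α) ‖ω⁽ᵏ⁾‖²)`, as a random variable. -/
def cvEstimator {Ω : Type*} {n K : ℕ} (g : EuclideanSpace ℝ (Fin n) → EuclideanSpace ℝ (Fin n))
    (Y : Ω → EuclideanSpace ℝ (Fin n)) (ω : Fin K → Ω → EuclideanSpace ℝ (Fin n)) (α : ℝ) :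
    Ω → ℝ := fun w ↦
  (1 / (K : ℝ)) * ∑ k, (‖testData α (Y w) (ω k w) - g (trainData α (Y w) (ω k w))‖ ^ 2
    - (1 / α) * ‖ω k w‖ ^ 2)

/-- The reducible variance `E[Var(X | Y)]`: the expectation of the conditional variance of `X`
given the `σ`-algebra generated by `Y`. -/
def reducibleVariance {Ω E : Type*} [MeasurableSpace Ω] [mE : MeasurableSpace E] (X : Ω → ℝ)
    (Y : Ω → E) (P : Measure Ω) : ℝ :=
  ∫ w, (Var[X; P | mE.comap Y]) w ∂P

end

/-! The antithetic noises sum to zero almost surely. Expanding the squares, the terms of order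
`1/√α` that are linear in the noise therefore cancel, and `CV_α` equals `‖Y - g(Y)‖²` plus the
average over `k` of `cvIncrement g α (Y, ω⁽ᵏ⁾)` (`cvEstimator_ae_eq`). The first summand is a
function of `Y` and does not affect the conditional variance.

The increment converges in `L²` to `2 zᵀ ∇g(y) z` (`tendsto_eLpNorm_cvIncrement`), and the reducible
variance is continuous under `L²` convergence (`tendsto_reducibleVariance`). The limit variable is
`∑ ∇g(Y)_{ab} W_{ab}` with `W = (2/K) ∑ₖ ω⁽ᵏ⁾ (ω⁽ᵏ⁾)ᵀ` independent of `Y`, so its reducible variance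
involves only second moments of `∇g(Y)` and the covariance of `W`. Isserlis' formula gives the
latter (`IsAntithetic.integral_noiseCoeff_mul`): one pairing produces the Frobenius norm, the other
the trace of the square.

The analytic difficulty is the difference quotient `⟨z, g(y + √α z) - g(y)⟩ / √α`. The Jacobian is
square integrable only under `N(θ, σ²I)`, whereas `y + t√α z` has a larger variance, so its law is
not dominated by a multiple of that one. On the region where `α‖y - θ‖⁴ ≤ 1` and `α‖z‖⁴ ≤ 1`,
however, the shift changes the density by at most the factor `exp(2/σ²)`
(`lintegral_indicator_shift_le`), and continuity of translations in `L²` applies. Off that region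
`1/√α` is bounded by a polynomial in `(y - θ, z)`, and Hölder's inequality with the `L⁴` continuity
of `g` suffices. This needs `g` in `L⁴` of a slightly wider Gaussian, which is what finiteness of
the second moment of `CV_{α₀}` provides. -/

/-- The density of the isotropic Gaussian law `N(θ, s² Iₙ)`. -/
noncomputable def isoGaussianPDF {n : ℕ} (s : ℝ) (θ y : EuclideanSpace ℝ (Fin n)) : ℝ :=
  ((2 * Real.pi * s ^ 2) ^ ((n : ℝ) / 2))⁻¹ * Real.exp (-(1 / (2 * s ^ 2)) * ‖y - θ‖ ^ 2)

/-! ### Densities, domination and shifts of isotropic Gaussian laws. -/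

section IsotropicGaussian

open scoped RealInnerProductSpace

variable {n : ℕ} {s : ℝ} {θ : EuclideanSpace ℝ (Fin n)}

theorem continuous_isoGaussianPDF (s : ℝ) (θ : EuclideanSpace ℝ (Fin n)) :
    Continuous (isoGaussianPDF s θ) := by
  unfold isoGaussianPDF; fun_prop

theorem isoGaussianPDF_pos (hs : 0 < s) (θ y : EuclideanSpace ℝ (Fin n)) :
    0 < isoGaussianPDF s θ y := by
  unfold isoGaussianPDF
  have := Real.pi_pos
  positivity

theorem posSemidef_sq_smul_one (s : ℝ) :
    (s ^ 2 • (1 : Matrix (Fin n) (Fin n) ℝ)).PosSemidef :=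
  Matrix.PosSemidef.one.smul (sq_nonneg s)

theorem charFun_isoGaussian (s : ℝ) (θ t : EuclideanSpace ℝ (Fin n)) :
    charFun (multivariateGaussian θ (s ^ 2 • (1 : Matrix (Fin n) (Fin n) ℝ))) t =
      Complex.exp (⟪t, θ⟫ * Complex.I - (s ^ 2 * ‖t‖ ^ 2 : ℝ) / 2) := by
  rw [charFun_multivariateGaussian (posSemidef_sq_smul_one s)]
  congr 3
  norm_cast
  rw [EuclideanSpace.real_norm_sq_eq, Matrix.smul_mulVec, Matrix.one_mulVec, dotProduct_smul,
    smul_eq_mul, dotProduct]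
  simp [sq]

theorem integrable_exp_neg_mul_sq_norm {b : ℝ} (hb : 0 < b) :
    Integrable (fun v : EuclideanSpace ℝ (Fin n) ↦ Real.exp (-b * ‖v‖ ^ 2)) := by
  have := (GaussianFourier.integrable_cexp_neg_mul_sq_norm_add (b := (b : ℂ)) (by simpa using hb) 0
    (0 : EuclideanSpace ℝ (Fin n))).re
  refine this.congr (ae_of_all _ fun v ↦ ?_)
  simp only [zero_mul, add_zero]
  have : (-(b : ℂ) * (‖v‖ : ℂ) ^ 2) = ((-b * ‖v‖ ^ 2 : ℝ) : ℂ) := by push_cast; ring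
  rw [this]
  exact Complex.exp_ofReal_re _

theorem integrable_isoGaussianPDF (hs : 0 < s) (θ : EuclideanSpace ℝ (Fin n)) :
    Integrable (isoGaussianPDF s θ) := by
  have h := (integrable_exp_neg_mul_sq_norm (n := n) (b := 1 / (2 * s ^ 2))
    (by positivity)).comp_sub_right θ
  exact h.const_mul _

theorem multivariateGaussian_eq_withDensity (hs : 0 < s) (θ : EuclideanSpace ℝ (Fin n)) :
    multivariateGaussian θ (s ^ 2 • (1 : Matrix (Fin n) (Fin n) ℝ)) =
      volume.withDensity (fun y ↦ ENNReal.ofReal (isoGaussianPDF s θ y)) := by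
  have hfin : IsFiniteMeasure
      (volume.withDensity (fun y ↦ ENNReal.ofReal (isoGaussianPDF s θ y))) :=
    isFiniteMeasure_withDensity_ofReal (integrable_isoGaussianPDF hs θ).2
  refine Measure.ext_of_charFun (funext fun t ↦ ?_)
  have hpi := Real.pi_pos
  rw [charFun_isoGaussian, charFun_apply,
    integral_withDensity_eq_integral_toReal_smul
      (continuous_isoGaussianPDF s θ).measurable.ennreal_ofReal (ae_of_all _ fun _ ↦ by simp),
    ← integral_add_right_eq_self _ θ]
  have key := GaussianFourier.integral_cexp_neg_mul_sq_norm_add (b := ((1 / (2 * s ^ 2) : ℝ) : ℂ))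
    (by rw [Complex.ofReal_re]; positivity) Complex.I t
  have hc : ((Real.pi : ℂ) / ((1 / (2 * s ^ 2) : ℝ) : ℂ)) ^
      (Module.finrank ℝ (EuclideanSpace ℝ (Fin n)) / 2 : ℂ) =
      (((2 * Real.pi * s ^ 2) ^ ((n : ℝ) / 2) : ℝ) : ℂ) := by
    rw [Complex.ofReal_cpow (by positivity), finrank_euclideanSpace_fin]
    congr 1
    · push_cast
      have : (s : ℂ) ≠ 0 := by simpa using hs.ne'
      field_simp
    · push_cast; rfl
  rw [hc] at key
  have hne : (((2 * Real.pi * s ^ 2) ^ ((n : ℝ) / 2) : ℝ) : ℂ) ≠ 0 := by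
    rw [Complex.ofReal_ne_zero]; positivity
  have : ∀ x : EuclideanSpace ℝ (Fin n),
      (ENNReal.ofReal (isoGaussianPDF s θ (x + θ))).toReal •
        Complex.exp (⟪x + θ, t⟫ * Complex.I) =
      ((((2 * Real.pi * s ^ 2) ^ ((n : ℝ) / 2) : ℝ) : ℂ)⁻¹ * Complex.exp (⟪t, θ⟫ * Complex.I)) *
        Complex.exp (-((1 / (2 * s ^ 2) : ℝ) : ℂ) * ‖x‖ ^ 2 + Complex.I * ⟪t, x⟫) := by
    intro x
    rw [ENNReal.toReal_ofReal (isoGaussianPDF_pos hs _ _).le, isoGaussianPDF, add_sub_cancel_right,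
      Complex.real_smul, inner_add_left, real_inner_comm x, real_inner_comm θ, Complex.exp_add]
    push_cast
    rw [add_mul, Complex.exp_add, mul_comm Complex.I]
    ring
  simp_rw [this]
  rw [integral_const_mul, key, sub_eq_add_neg, Complex.exp_add]
  have hs' : (s : ℂ) ≠ 0 := by simpa using hs.ne'
  have e : Complex.I ^ 2 * (‖t‖ : ℂ) ^ 2 / (4 * ((1 / (2 * s ^ 2) : ℝ) : ℂ)) =
      -((s ^ 2 * ‖t‖ ^ 2 : ℝ) / 2) := by
    rw [Complex.I_sq]
    push_cast
    field_simp
    ring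
  rw [e]
  generalize (((2 * Real.pi * s ^ 2) ^ ((n : ℝ) / 2) : ℝ) : ℂ) = c at hne ⊢
  field_simp

theorem isoGaussian_absolutelyContinuous (hs : 0 < s) (θ : EuclideanSpace ℝ (Fin n)) :
    multivariateGaussian θ (s ^ 2 • (1 : Matrix (Fin n) (Fin n) ℝ)) ≪ volume := by
  rw [multivariateGaussian_eq_withDensity hs]
  exact withDensity_absolutelyContinuous _ _

/-- The exponential factor increases with the scale and the normalising factor decreases, so the
density ratio is at most the ratio of the normalisations at `s₀` and `s₁`. -/
theorem isoGaussian_le_smul {s₀ s₁ : ℝ} (hs₀ : 0 < s₀) (hs₁ : 0 < s₁)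
    (θ : EuclideanSpace ℝ (Fin n)) :
    ∃ C : ENNReal, C ≠ ⊤ ∧ ∀ s, s₀ ≤ s → s ≤ s₁ →
      multivariateGaussian θ (s ^ 2 • (1 : Matrix (Fin n) (Fin n) ℝ)) ≤
        C • multivariateGaussian θ (s₁ ^ 2 • (1 : Matrix (Fin n) (Fin n) ℝ)) := by
  have hpi := Real.pi_pos
  refine ⟨ENNReal.ofReal ((2 * Real.pi * s₁ ^ 2) ^ ((n : ℝ) / 2) *
    ((2 * Real.pi * s₀ ^ 2) ^ ((n : ℝ) / 2))⁻¹), ENNReal.ofReal_ne_top, fun s h₀ h₁ ↦ ?_⟩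
  have hs : 0 < s := hs₀.trans_le h₀
  rw [multivariateGaussian_eq_withDensity hs, multivariateGaussian_eq_withDensity hs₁,
    ← withDensity_smul _ (continuous_isoGaussianPDF s₁ θ).measurable.ennreal_ofReal]
  refine withDensity_mono (ae_of_all _ fun y ↦ ?_)
  rw [Pi.smul_apply, smul_eq_mul, ← ENNReal.ofReal_mul (by positivity)]
  refine ENNReal.ofReal_le_ofReal ?_
  unfold isoGaussianPDF
  rw [show ∀ a b c d : ℝ, a * b * (c * d) = (a * c) * (b * d) by intros; ring,
    mul_inv_cancel₀ (by positivity), one_mul]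
  gcongr

theorem map_add_smul_isoGaussian (σ : ℝ) {α : ℝ} (hα : 0 ≤ α) (θ : EuclideanSpace ℝ (Fin n)) :
    ((multivariateGaussian θ (σ ^ 2 • (1 : Matrix (Fin n) (Fin n) ℝ))).prod
      (multivariateGaussian 0 (σ ^ 2 • (1 : Matrix (Fin n) (Fin n) ℝ)))).map
        (fun p ↦ p.1 + √α • p.2) =
      multivariateGaussian θ ((σ * √(1 + α)) ^ 2 • (1 : Matrix (Fin n) (Fin n) ℝ)) := by
  have : IsProbabilityMeasure (((multivariateGaussian θ (σ ^ 2 • (1 : Matrix (Fin n) (Fin n) ℝ))).prod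
      (multivariateGaussian 0 (σ ^ 2 • (1 : Matrix (Fin n) (Fin n) ℝ)))).map
        (fun p ↦ p.1 + √α • p.2)) := Measure.isProbabilityMeasure_map (by fun_prop)
  refine Measure.ext_of_charFun (funext fun t ↦ ?_)
  rw [charFun_isoGaussian, charFun_apply, integral_map (by fun_prop) (by fun_prop)]
  have : ∀ p : EuclideanSpace ℝ (Fin n) × EuclideanSpace ℝ (Fin n),
      Complex.exp (⟪p.1 + √α • p.2, t⟫ * Complex.I) =
      Complex.exp (⟪p.1, t⟫ * Complex.I) * Complex.exp (⟪p.2, √α • t⟫ * Complex.I) := by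
    intro p
    rw [← Complex.exp_add, inner_add_left, inner_smul_left, inner_smul_right]
    congr 1; push_cast; simp; ring
  simp_rw [this]
  rw [integral_prod_mul (fun y : EuclideanSpace ℝ (Fin n) ↦ Complex.exp (⟪y, t⟫ * Complex.I))
    (fun y : EuclideanSpace ℝ (Fin n) ↦ Complex.exp (⟪y, √α • t⟫ * Complex.I)),
    ← charFun_apply, ← charFun_apply, charFun_isoGaussian, charFun_isoGaussian, ← Complex.exp_add,
    norm_smul, mul_pow, mul_pow, Real.norm_eq_abs, sq_abs, Real.sq_sqrt hα,
    Real.sq_sqrt (by linarith)]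
  congr 1
  simp
  ring

/-- On the region where both the centred point and the shift are moderate, shifting the argument
costs at most a constant factor under a Gaussian law. -/
theorem lintegral_indicator_shift_le (hs : 0 < s) (θ z : EuclideanSpace ℝ (Fin n)) {α h : ℝ}
    (hα : 0 ≤ α) (hα1 : α ≤ 1) (h0 : 0 ≤ h) (hh : h ≤ √α) {F : EuclideanSpace ℝ (Fin n) → ENNReal}
    (hF : Measurable F) :
    ∫⁻ y, {y | α * ‖y - θ‖ ^ 4 ≤ 1 ∧ α * ‖z‖ ^ 4 ≤ 1}.indicator (fun y ↦ F (y + h • z)) y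
        ∂(multivariateGaussian θ (s ^ 2 • (1 : Matrix (Fin n) (Fin n) ℝ))) ≤
      ENNReal.ofReal (Real.exp (2 / s ^ 2)) *
        ∫⁻ y, F y ∂(multivariateGaussian θ (s ^ 2 • (1 : Matrix (Fin n) (Fin n) ℝ))) := by
  have hm := (continuous_isoGaussianPDF s θ).measurable.ennreal_ofReal
  have hset : MeasurableSet {y | α * ‖y - θ‖ ^ 4 ≤ 1 ∧ α * ‖z‖ ^ 4 ≤ 1} := by
    exact (measurableSet_le (f := fun y ↦ α * ‖y - θ‖ ^ 4) (g := fun _ ↦ 1) (by fun_prop)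
      (by fun_prop)).inter (measurableSet_le (f := fun _ ↦ α * ‖z‖ ^ 4) (g := fun _ ↦ 1)
      (by fun_prop) (by fun_prop))
  have hF' : Measurable fun y ↦ F (y + h • z) := hF.comp (by fun_prop)
  -- Translation invariance of Lebesgue measure puts the shift on the density of the right-hand
  -- side, which leaves a pointwise comparison of the densities at `y` and `y + h • z`.
  rw [multivariateGaussian_eq_withDensity hs,
    lintegral_withDensity_eq_lintegral_mul _ hm
      (hF'.indicator hset),
    lintegral_withDensity_eq_lintegral_mul _ hm hF, ← lintegral_const_mul _ (hm.mul hF),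
    ← lintegral_add_right_eq_self
      (fun y ↦ _ * ((fun y ↦ ENNReal.ofReal (isoGaussianPDF s θ y)) * F) y) (h • z)]
  refine lintegral_mono fun y ↦ ?_
  simp only [Pi.mul_apply]
  by_cases hy : y ∈ {y | α * ‖y - θ‖ ^ 4 ≤ 1 ∧ α * ‖z‖ ^ 4 ≤ 1}
  swap
  · simp [Set.indicator_of_notMem hy]
  rw [Set.indicator_of_mem hy, ← mul_assoc, ← ENNReal.ofReal_mul (Real.exp_pos _).le]
  refine mul_le_mul_left ?_ _
  refine ENNReal.ofReal_le_ofReal ?_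
  obtain ⟨hy1, hz1⟩ := hy
  have hpi := Real.pi_pos
  unfold isoGaussianPDF
  rw [mul_left_comm, ← Real.exp_add]
  gcongr
  have e : y + h • z - θ = (y - θ) + h • z := by abel
  rw [e, norm_add_sq_real, inner_smul_right, norm_smul, Real.norm_of_nonneg h0]
  have hh2 : h ^ 2 ≤ α := by
    calc h ^ 2 ≤ √α ^ 2 := by gcongr
      _ = α := Real.sq_sqrt hα
  -- The exponent changes by `(2h⟨y - θ, z⟩ + h²‖z‖²) / (2s²)`. Both products are at most `1` on the
  -- region, so the numerator is at most `3`; the constant `2 / s²` allows `4`.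
  have h1 : h * ⟪y - θ, z⟫ ≤ 1 := by
    have h2 : h * ⟪y - θ, z⟫ ≤ h * (‖y - θ‖ * ‖z‖) := by
      gcongr; exact real_inner_le_norm _ _
    refine h2.trans ?_
    have : (h * (‖y - θ‖ * ‖z‖)) ^ 4 ≤ 1 := by
      calc (h * (‖y - θ‖ * ‖z‖)) ^ 4 = (h ^ 2) ^ 2 * (‖y - θ‖ ^ 4 * ‖z‖ ^ 4) := by ring
        _ ≤ α ^ 2 * (‖y - θ‖ ^ 4 * ‖z‖ ^ 4) := by gcongr
        _ = (α * ‖y - θ‖ ^ 4) * (α * ‖z‖ ^ 4) := by ring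
        _ ≤ 1 * 1 := by gcongr
        _ = 1 := one_mul _
    exact (pow_le_one_iff_of_nonneg (by positivity) (by norm_num)).1 this
  have h3 : h ^ 2 * ‖z‖ ^ 2 ≤ 1 := by
    have : (h ^ 2 * ‖z‖ ^ 2) ^ 2 ≤ 1 := by
      calc (h ^ 2 * ‖z‖ ^ 2) ^ 2 = (h ^ 2) * (h ^ 2 * ‖z‖ ^ 4) := by ring
        _ ≤ α * (α * ‖z‖ ^ 4) := by gcongr
        _ ≤ 1 * 1 := by gcongr
        _ = 1 := one_mul _
    exact (pow_le_one_iff_of_nonneg (by positivity) (by norm_num)).1 this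
  have h4 : 2 / s ^ 2 = (1 / (2 * s ^ 2)) * 4 := by field_simp; norm_num
  rw [h4]
  have h5 : 0 ≤ 1 / (2 * s ^ 2) := by positivity
  nlinarith [mul_le_mul_of_nonneg_left (show 2 * (h * ⟪y - θ, z⟫) + h ^ 2 * ‖z‖ ^ 2 ≤ 4 by linarith) h5]

end IsotropicGaussian

/-! ### Continuity of composition in `Lᵖ`. -/

section Translation

open scoped ENNReal BoundedContinuousFunction

variable {X E V ι : Type*} [MeasurableSpace X]

theorem tendsto_eLpNorm_zero_of_bounded [NormedAddCommGroup V] {ρ : Measure X} [IsFiniteMeasure ρ]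
    {l : Filter ι} [l.IsCountablyGenerated] {f : ι → X → V} {p : ℝ≥0∞} (hp0 : p ≠ 0) (hp : p ≠ ⊤)
    {M : ℝ} (hm : ∀ i, AEStronglyMeasurable (f i) ρ) (hM : ∀ i x, ‖f i x‖ ≤ M)
    (hf : ∀ᵐ x ∂ρ, Tendsto (fun i ↦ f i x) l (𝓝 0)) :
    Tendsto (fun i ↦ eLpNorm (f i) p ρ) l (𝓝 0) := by
  have hpr : 0 < p.toReal := ENNReal.toReal_pos hp0 hp
  have h1 : Tendsto (fun i ↦ ∫⁻ x, ‖f i x‖ₑ ^ p.toReal ∂ρ) l (𝓝 (∫⁻ _, 0 ∂ρ)) := by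
    refine tendsto_lintegral_filter_of_dominated_convergence' (fun _ ↦ ENNReal.ofReal M ^ p.toReal)
      (Eventually.of_forall fun i ↦ (hm i).enorm.pow_const _)
      (Eventually.of_forall fun i ↦ ae_of_all _ fun x ↦ ?_) ?_ ?_
    · gcongr
      rw [← ofReal_norm]
      exact ENNReal.ofReal_le_ofReal (hM i x)
    · rw [lintegral_const]
      exact ENNReal.mul_ne_top (by simp [hpr.le]) (measure_ne_top _ _)
    · filter_upwards [hf] with x hx
      have := (hx.enorm).ennrpow_const p.toReal
      simpa [hpr] using this
  have h2 := h1.ennrpow_const (1 / p.toReal)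
  simp only [lintegral_zero, one_div, ENNReal.zero_rpow_of_pos (inv_pos.2 hpr)] at h2
  refine h2.congr fun i ↦ ?_
  rw [eLpNorm_eq_lintegral_rpow_enorm_toReal hp0 hp, one_div]

/-- Continuity of `τ ↦ F ∘ τ` in `Lᵖ` for maps `τ` that push a finite measure to measures
dominated by a multiple of a fixed one. -/
theorem tendsto_eLpNorm_comp_sub_comp [NormedAddCommGroup V] [NormedSpace ℝ V]
    [SecondCountableTopology V] [MeasurableSpace V] [BorelSpace V]
    [NormedAddCommGroup E] [MeasurableSpace E] [BorelSpace E] [SecondCountableTopology E]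
    [CompleteSpace E]
    {ρ : Measure X} [IsFiniteMeasure ρ] {γ : Measure E} [IsFiniteMeasure γ]
    {l : Filter ι} [l.IsCountablyGenerated] {ρ' : ι → Measure X} (hρ : ∀ᶠ i in l, ρ' i ≤ ρ)
    {τ : ι → X → E} {τ₀ : X → E} (hτm : ∀ i, Measurable (τ i)) (hτ₀m : Measurable τ₀)
    (hτ : ∀ x, Tendsto (fun i ↦ τ i x) l (𝓝 (τ₀ x))) {C : ℝ≥0∞} (hC : C ≠ ⊤)
    (hCτ : ∀ᶠ i in l, (ρ' i).map (τ i) ≤ C • γ) (hCτ₀ : ∀ᶠ i in l, (ρ' i).map τ₀ ≤ C • γ)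
    {p : ℝ≥0∞} (hp1 : 1 ≤ p) (hp : p ≠ ⊤) {F : E → V} (hFm : Measurable F) (hF : MemLp F p γ) :
    Tendsto (fun i ↦ eLpNorm (fun x ↦ F (τ i x) - F (τ₀ x)) p (ρ' i)) l (𝓝 0) := by
  have hp0 : p ≠ 0 := (zero_lt_one.trans_le hp1).ne'
  rw [ENNReal.tendsto_nhds_zero]
  intro ε hε
  have hε3 : ε / 3 ≠ 0 := ENNReal.div_ne_zero.2 ⟨hε.ne', by simp⟩
  have hC' : C ^ (1 / p.toReal) ≠ ⊤ := ENNReal.rpow_ne_top_of_nonneg (by positivity) hC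
  obtain ⟨δ, hδ, hδε⟩ := ENNReal.exists_nnreal_pos_mul_lt hC' hε3
  -- The error of replacing `F` by `H` is measured under `γ` and transfers to both image measures at
  -- the cost of `C ^ (1/p)`, uniformly in `i`. Only the bounded continuous `H` needs convergence of
  -- `τ i`, and that is done under the fixed measure `ρ`.
  obtain ⟨H, hH, -⟩ := hF.exists_boundedContinuous_eLpNorm_sub_le hp
    (ε := δ) (by simpa using hδ.ne')
  have hHm : Measurable H := H.continuous.measurable
  have key : ∀ (i : ι) (τ' : X → E), Measurable τ' → (ρ' i).map τ' ≤ C • γ →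
      eLpNorm (fun x ↦ F (τ' x) - H (τ' x)) p (ρ' i) ≤ ε / 3 := by
    intro i τ' hm hle
    have : eLpNorm (fun x ↦ F (τ' x) - H (τ' x)) p (ρ' i) =
        eLpNorm (F - (H : E → V)) p ((ρ' i).map τ') := by
      rw [eLpNorm_map_measure (hFm.sub hHm).aestronglyMeasurable hm.aemeasurable]
      rfl
    rw [this]
    calc eLpNorm (F - (H : E → V)) p ((ρ' i).map τ')
        ≤ eLpNorm (F - (H : E → V)) p (C • γ) := eLpNorm_mono_measure _ hle
      _ = C ^ (1 / p.toReal) • eLpNorm (F - (H : E → V)) p γ := by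
          rw [eLpNorm_smul_measure_of_ne_top hp, ENNReal.toReal_div, ENNReal.toReal_one]
      _ ≤ C ^ (1 / p.toReal) • (δ : ℝ≥0∞) := by
          rw [smul_eq_mul, smul_eq_mul]; gcongr
      _ ≤ ε / 3 := by rw [smul_eq_mul, mul_comm]; exact hδε.le
  have hcont : Tendsto (fun i ↦ eLpNorm (fun x ↦ H (τ i x) - H (τ₀ x)) p ρ) l (𝓝 0) := by
    refine tendsto_eLpNorm_zero_of_bounded hp0 hp (M := 2 * ‖H‖)
      (fun i ↦ ((hHm.comp (hτm i)).sub (hHm.comp hτ₀m)).aestronglyMeasurable)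
      (fun i x ↦ ?_) (ae_of_all _ fun x ↦ ?_)
    · rw [← dist_eq_norm]; exact H.dist_le_two_norm _ _
    · have := ((H.continuous.tendsto _).comp (hτ x)).sub_const (H (τ₀ x))
      simpa using this
  filter_upwards [hρ, hCτ, hCτ₀, (ENNReal.tendsto_nhds_zero.1 hcont) (ε / 3)
    (pos_iff_ne_zero.2 hε3)] with i h1 h2 h3 h4
  have e : (fun x ↦ F (τ i x) - F (τ₀ x)) = ((fun x ↦ F (τ i x) - H (τ i x)) +
      (fun x ↦ H (τ i x) - H (τ₀ x))) - (fun x ↦ F (τ₀ x) - H (τ₀ x)) := by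
    funext x; simp
  have m1 : AEStronglyMeasurable (fun x ↦ F (τ i x) - H (τ i x)) (ρ' i) :=
    ((hFm.comp (hτm i)).sub (hHm.comp (hτm i))).aestronglyMeasurable
  have m2 : AEStronglyMeasurable (fun x ↦ H (τ i x) - H (τ₀ x)) (ρ' i) :=
    ((hHm.comp (hτm i)).sub (hHm.comp hτ₀m)).aestronglyMeasurable
  have m3 : AEStronglyMeasurable (fun x ↦ F (τ₀ x) - H (τ₀ x)) (ρ' i) :=
    ((hFm.comp hτ₀m).sub (hHm.comp hτ₀m)).aestronglyMeasurable
  rw [e]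
  calc _ ≤ _ := eLpNorm_sub_le (m1.add m2) m3 hp1
    _ ≤ (eLpNorm (fun x ↦ F (τ i x) - H (τ i x)) p (ρ' i) +
          eLpNorm (fun x ↦ H (τ i x) - H (τ₀ x)) p (ρ' i)) +
          eLpNorm (fun x ↦ F (τ₀ x) - H (τ₀ x)) p (ρ' i) := by
        gcongr; exact eLpNorm_add_le m1 m2 hp1
    _ ≤ (ε / 3 + ε / 3) + ε / 3 := by
        gcongr
        · exact key i _ (hτm i) h2
        · exact (eLpNorm_mono_measure _ h1).trans h4
        · exact key i _ hτ₀m h3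
    _ = ε := ENNReal.add_thirds ε

end Translation

/-- The isotropic Gaussian law `N(θ, σ² Iₙ)`. -/
noncomputable abbrev isoGaussian {n : ℕ} (σ : ℝ) (θ : EuclideanSpace ℝ (Fin n)) :
    Measure (EuclideanSpace ℝ (Fin n)) :=
  multivariateGaussian θ (σ ^ 2 • (1 : Matrix (Fin n) (Fin n) ℝ))

instance holderTriple_four_four_two : ENNReal.HolderTriple 4 4 2 where
  inv_add_inv_eq_inv := by
    rw [← ENNReal.toReal_eq_toReal_iff' (by simp) (by simp), ENNReal.toReal_add (by simp) (by simp)]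
    simp only [ENNReal.toReal_inv]
    norm_num

theorem eLpNorm_two_pow_two {X V : Type*} [MeasurableSpace X] [NormedAddCommGroup V]
    (μ : Measure X) (f : X → V) : eLpNorm f 2 μ ^ 2 = ∫⁻ x, ‖f x‖ₑ ^ 2 ∂μ := by
  simpa using eLpNorm_nnreal_pow_eq_lintegral (μ := μ) (f := f) (p := 2) (by simp)

theorem eLpNorm_two_le_mul_eLpNorm_four {X V W V' : Type*} [MeasurableSpace X]
    [NormedAddCommGroup V] [NormedAddCommGroup W] [NormedAddCommGroup V'] {μ : Measure X}
    {f : X → V'} {u : X → V} {v : X → W} (hu : AEStronglyMeasurable u μ)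
    (hv : AEStronglyMeasurable v μ) (h : ∀ᵐ x ∂μ, ‖f x‖ ≤ ‖u x‖ * ‖v x‖) :
    eLpNorm f 2 μ ≤ eLpNorm u 4 μ * eLpNorm v 4 μ := by
  have h1 : eLpNorm f 2 μ ≤ eLpNorm (fun x ↦ ‖u x‖ * ‖v x‖) 2 μ :=
    eLpNorm_mono_ae (by filter_upwards [h] with x hx; rw [Real.norm_of_nonneg (by positivity)]; exact hx)
  refine h1.trans ?_
  have := eLpNorm_le_eLpNorm_mul_eLpNorm'_of_norm (p := 4) (q := 4) (r := 2) hu.norm hv.norm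
    (fun a b : ℝ ↦ a * b) 1 (ae_of_all _ fun x ↦ by simp)
  simpa using this

/-! ### Small Gaussian perturbations and the moderate region. -/

section GaussianPerturbation

open scoped ENNReal RealInnerProductSpace

variable {n : ℕ} {σ : ℝ} {θ : EuclideanSpace ℝ (Fin n)}

/-- The perturbed laws are isotropic Gaussians with scales between `σ` and `σ * √(1 + α₀)`, so the
widest one dominates them with a single constant. -/
theorem map_add_smul_isoGaussian_le (hσ : 0 < σ) {α₀ : ℝ} (hα₀ : 0 < α₀)
    (θ : EuclideanSpace ℝ (Fin n)) :
    ∃ C : ℝ≥0∞, C ≠ ⊤ ∧ ∀ α, 0 ≤ α → α ≤ α₀ →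
      ((isoGaussian σ θ).prod (isoGaussian σ 0)).map (fun p ↦ p.1 + √α • p.2) ≤
        C • isoGaussian (σ * √(1 + α₀)) θ := by
  obtain ⟨C, hC, h⟩ := isoGaussian_le_smul (n := n) (s₀ := σ) (s₁ := σ * √(1 + α₀)) hσ
    (by positivity) θ
  refine ⟨C, hC, fun α h0 h1 ↦ ?_⟩
  rw [map_add_smul_isoGaussian σ h0]
  refine h _ ?_ (by gcongr)
  exact le_mul_of_one_le_right hσ.le (Real.one_le_sqrt.2 (by linarith))

theorem tendsto_eLpNorm_perturb_sub (hσ : 0 < σ) {α₀ : ℝ} (hα₀ : 0 < α₀)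
    (θ : EuclideanSpace ℝ (Fin n)) {V : Type*} [NormedAddCommGroup V] [NormedSpace ℝ V]
    [SecondCountableTopology V] [MeasurableSpace V] [BorelSpace V]
    {g : EuclideanSpace ℝ (Fin n) → V} (hg : Measurable g) {p : ℝ≥0∞} (hp1 : 1 ≤ p) (hp : p ≠ ⊤)
    (hgp : MemLp g p (isoGaussian (σ * √(1 + α₀)) θ)) :
    Tendsto (fun α ↦ eLpNorm (fun q : EuclideanSpace ℝ (Fin n) × EuclideanSpace ℝ (Fin n) ↦
        g (q.1 + √α • q.2) - g q.1) p ((isoGaussian σ θ).prod (isoGaussian σ 0)))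
      (𝓝[>] 0) (𝓝 0) := by
  obtain ⟨C, hC, h⟩ := map_add_smul_isoGaussian_le hσ hα₀ θ
  refine tendsto_eLpNorm_comp_sub_comp (ρ := (isoGaussian σ θ).prod (isoGaussian σ 0))
    (τ := fun α q ↦ q.1 + √α • q.2) (τ₀ := fun q ↦ q.1)
    (ρ' := fun _ ↦ (isoGaussian σ θ).prod (isoGaussian σ 0))
    (Eventually.of_forall fun _ ↦ le_rfl) (fun α ↦ by fun_prop) (by fun_prop) (fun q ↦ ?_) hC ?_
    (Eventually.of_forall fun _ ↦ by simpa using h 0 le_rfl hα₀.le) hp1 hp hg hgp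
  · have : Continuous fun α : ℝ ↦ q.1 + √α • q.2 := by fun_prop
    have h2 := (this.tendsto 0).mono_left (nhdsWithin_le_nhds (s := Set.Ioi 0))
    simpa using h2
  · filter_upwards [Ioc_mem_nhdsGT hα₀] with α hα
    exact h α hα.1.le hα.2

theorem memLp_isoGaussian_prod {p : ℝ≥0∞} (hp : p ≠ ⊤) (θ : EuclideanSpace ℝ (Fin n)) :
    MemLp (fun q : EuclideanSpace ℝ (Fin n) × EuclideanSpace ℝ (Fin n) ↦ q - (θ, 0)) p
      ((isoGaussian σ θ).prod (isoGaussian σ 0)) := by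
  have : IsGaussian ((isoGaussian σ θ).prod (isoGaussian σ (0 : EuclideanSpace ℝ (Fin n)))) :=
    inferInstance
  exact (IsGaussian.memLp_id _ p hp).sub (memLp_const _)

/-- The region on which both the centred data and the noise are of size at most `α^(-1/4)`. -/
def moderateRegion {n : ℕ} (α : ℝ) (θ : EuclideanSpace ℝ (Fin n)) :
    Set (EuclideanSpace ℝ (Fin n) × EuclideanSpace ℝ (Fin n)) :=
  {q | α * ‖q.1 - θ‖ ^ 4 ≤ 1 ∧ α * ‖q.2‖ ^ 4 ≤ 1}

theorem measurableSet_moderateRegion (α : ℝ) (θ : EuclideanSpace ℝ (Fin n)) :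
    MeasurableSet (moderateRegion α θ) :=
  (measurableSet_le (f := fun q : EuclideanSpace ℝ (Fin n) × EuclideanSpace ℝ (Fin n) ↦
      α * ‖q.1 - θ‖ ^ 4) (g := fun _ ↦ 1) (by fun_prop) (by fun_prop)).inter
    (measurableSet_le (f := fun q : EuclideanSpace ℝ (Fin n) × EuclideanSpace ℝ (Fin n) ↦
      α * ‖q.2‖ ^ 4) (g := fun _ ↦ 1) (by fun_prop) (by fun_prop))

/-- Off the region one of the two norms exceeds `α^(-1/4)`. This lets the singular factor of the
difference quotient be replaced by a moment that does not depend on `α`. -/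
theorem one_div_sqrt_le_of_notMem_moderateRegion {α : ℝ} (hα : 0 < α)
    {q : EuclideanSpace ℝ (Fin n) × EuclideanSpace ℝ (Fin n)} (hq : q ∉ moderateRegion α θ) :
    1 / √α ≤ ‖q - (θ, 0)‖ ^ 2 := by
  have h1 : ‖q.1 - θ‖ ≤ ‖q - (θ, 0)‖ := norm_fst_le (q - (θ, 0))
  have h2 : ‖q.2‖ ≤ ‖q - (θ, 0)‖ := by
    have := norm_snd_le (q - (θ, 0))
    rwa [Prod.snd_sub, sub_zero] at this
  have h3 : 1 ≤ α * ‖q - (θ, 0)‖ ^ 4 := by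
    by_contra! hlt
    refine hq ⟨?_, ?_⟩
    · exact (mul_le_mul_of_nonneg_left (pow_le_pow_left₀ (norm_nonneg _) h1 4) hα.le).trans hlt.le
    · exact (mul_le_mul_of_nonneg_left (pow_le_pow_left₀ (norm_nonneg _) h2 4) hα.le).trans hlt.le
  rw [div_le_iff₀ (Real.sqrt_pos.2 hα)]
  have h4 : 1 ≤ (‖q - (θ, 0)‖ ^ 2 * √α) ^ 2 := by
    rw [mul_pow, Real.sq_sqrt hα.le]; linarith [h3]
  exact (one_le_sq_iff₀ (by positivity)).1 h4

/-- The cube is the weight used off the moderate region: two factors absorb `1/√α` and the third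
bounds the noise. -/
theorem memLp_norm_pow_isoGaussian_prod (θ : EuclideanSpace ℝ (Fin n)) :
    MemLp (fun q : EuclideanSpace ℝ (Fin n) × EuclideanSpace ℝ (Fin n) ↦ ‖q - (θ, 0)‖ ^ 3) 4
      ((isoGaussian σ θ).prod (isoGaussian σ 0)) := by
  have h := (memLp_isoGaussian_prod (σ := σ) (p := 12) (by simp) θ).norm_rpow_div 3
  have e : (12 : ℝ≥0∞) / 3 = 4 := by
    rw [← ENNReal.toReal_eq_toReal_iff' (by finiteness) (by simp), ENNReal.toReal_div]
    norm_num
  rw [e] at h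
  refine h.congr_norm ((by fun_prop : Continuous _).aestronglyMeasurable) (ae_of_all _ fun q ↦ ?_)
  simp

/-- Each fixed point lies in the region once `α` is small, so dominated convergence applies with
bound `‖f‖²`. -/
theorem tendsto_eLpNorm_indicator_compl_moderateRegion {V : Type*} [NormedAddCommGroup V]
    {μ : Measure (EuclideanSpace ℝ (Fin n) × EuclideanSpace ℝ (Fin n))}
    (θ : EuclideanSpace ℝ (Fin n))
    {f : EuclideanSpace ℝ (Fin n) × EuclideanSpace ℝ (Fin n) → V} (hf : MemLp f 2 μ) :
    Tendsto (fun α ↦ eLpNorm ((moderateRegion α θ)ᶜ.indicator f) 2 μ) (𝓝[>] 0) (𝓝 0) := by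
  have h1 : Tendsto (fun α ↦ ∫⁻ x, ‖(moderateRegion α θ)ᶜ.indicator f x‖ₑ ^ (2 : ℝ) ∂μ) (𝓝[>] 0)
      (𝓝 (∫⁻ _, 0 ∂μ)) := by
    refine tendsto_lintegral_filter_of_dominated_convergence' (fun x ↦ ‖f x‖ₑ ^ (2 : ℝ))
      (Eventually.of_forall fun α ↦
        ((hf.1.indicator (measurableSet_moderateRegion α θ).compl).enorm.pow_const _))
      (Eventually.of_forall fun α ↦ ae_of_all _ fun x ↦ ?_) ?_ (ae_of_all _ fun x ↦ ?_)
    · gcongr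
      exact enorm_indicator_le_enorm_self f x
    · have := lintegral_rpow_enorm_lt_top_of_eLpNorm_lt_top (by simp) (by simp) hf.2
      simpa using this.ne
    · refine tendsto_const_nhds.congr' ?_
      have hc : ∀ c : ℝ, ∀ᶠ α in 𝓝[>] (0 : ℝ), α * c ≤ 1 := by
        intro c
        have : Tendsto (fun α : ℝ ↦ α * c) (𝓝[>] 0) (𝓝 (0 * c)) :=
          (tendsto_id.mono_left nhdsWithin_le_nhds).mul_const c
        rw [zero_mul] at this
        filter_upwards [this.eventually (gt_mem_nhds zero_lt_one)] with α hα using hα.le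
      filter_upwards [hc (‖x.1 - θ‖ ^ 4), hc (‖x.2‖ ^ 4)] with α ha hb
      rw [Set.indicator_of_notMem (Set.notMem_compl_iff.2 (show x ∈ moderateRegion α θ from ⟨ha, hb⟩))]
      simp
  have h2 := h1.ennrpow_const (1 / 2)
  simp only [lintegral_zero, one_div, ENNReal.zero_rpow_of_pos (by norm_num : (0 : ℝ) < 2⁻¹)] at h2
  refine h2.congr fun α ↦ ?_
  rw [eLpNorm_eq_lintegral_rpow_enorm_toReal (by simp) (by simp)]
  simp

end GaussianPerturbation

/-! ### `L²` continuity of shifts on the moderate region. -/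

section GaussianJacobian

open scoped ENNReal RealInnerProductSpace

variable {n : ℕ} {σ : ℝ} {θ : EuclideanSpace ℝ (Fin n)}

/-- The quadratic form `zᵀ A z`. -/
def quadForm {n : ℕ} (A : Fin n → Fin n → ℝ) (z : EuclideanSpace ℝ (Fin n)) : ℝ :=
  ∑ i, z i * ∑ j, z j * A i j

theorem lintegral_enorm_pow_isoGaussian_lt_top (k : ℕ) :
    ∫⁻ z : EuclideanSpace ℝ (Fin n), ‖z‖ₑ ^ k ∂(isoGaussian σ 0) < ⊤ := by
  rcases Nat.eq_zero_or_pos k with rfl | hk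
  · simp
  have h := (IsGaussian.memLp_id (isoGaussian σ (0 : EuclideanSpace ℝ (Fin n))) k (by simp)).2
  have := lintegral_rpow_enorm_lt_top_of_eLpNorm_lt_top (by simpa using hk.ne') (by simp) h
  simpa using this

/-- For fixed `t` and `z` this is `lintegral_indicator_shift_le` applied to the indicator of a set;
integrating over `z` gives the fourth moment, and integrating over `t` in the unit interval costs
nothing. A general step `h` covers both the shifted and the unshifted map. -/
theorem map_withDensity_moderateRegion_le (hσ : 0 < σ) (θ : EuclideanSpace ℝ (Fin n)) {α : ℝ}
    (hα : 0 ≤ α) (hα1 : α ≤ 1) {h : ℝ → ℝ} (hm : Measurable h)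
    (hh : ∀ t ∈ Set.Ioc (0 : ℝ) 1, 0 ≤ h t ∧ h t ≤ √α) :
    ((((isoGaussian σ θ).prod (isoGaussian σ 0)).prod (volume.restrict (Set.Ioc (0 : ℝ) 1))).withDensity
        (fun x ↦ (moderateRegion α θ).indicator (fun q ↦ ‖q.2‖ₑ ^ 4) x.1)).map
        (fun x ↦ x.1.1 + h x.2 • x.1.2) ≤
      (ENNReal.ofReal (Real.exp (2 / σ ^ 2)) *
        ∫⁻ z : EuclideanSpace ℝ (Fin n), ‖z‖ₑ ^ 4 ∂(isoGaussian σ 0)) • isoGaussian σ θ := by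
  have hden : Measurable (fun q : EuclideanSpace ℝ (Fin n) × EuclideanSpace ℝ (Fin n) ↦
      (moderateRegion α θ).indicator (fun q ↦ ‖q.2‖ₑ ^ 4) q) :=
    (by fun_prop : Measurable fun q : EuclideanSpace ℝ (Fin n) × EuclideanSpace ℝ (Fin n) ↦
      ‖q.2‖ₑ ^ 4).indicator (measurableSet_moderateRegion α θ)
  have hτ : Measurable (fun x : (EuclideanSpace ℝ (Fin n) × EuclideanSpace ℝ (Fin n)) × ℝ ↦
      x.1.1 + h x.2 • x.1.2) := by fun_prop
  have hden' : Measurable (fun x : (EuclideanSpace ℝ (Fin n) × EuclideanSpace ℝ (Fin n)) × ℝ ↦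
      (moderateRegion α θ).indicator (fun q ↦ ‖q.2‖ₑ ^ 4) x.1) := hden.comp measurable_fst
  refine Measure.le_intro fun s hs _ ↦ ?_
  set F : EuclideanSpace ℝ (Fin n) → ℝ≥0∞ := s.indicator 1 with hF
  have hFm : Measurable F := measurable_one.indicator hs
  have hFτ : Measurable (fun x : (EuclideanSpace ℝ (Fin n) × EuclideanSpace ℝ (Fin n)) × ℝ ↦
      F (x.1.1 + h x.2 • x.1.2)) := hFm.comp hτ
  have hint : Measurable (fun x : (EuclideanSpace ℝ (Fin n) × EuclideanSpace ℝ (Fin n)) × ℝ ↦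
      (moderateRegion α θ).indicator (fun q ↦ ‖q.2‖ₑ ^ 4) x.1 * F (x.1.1 + h x.2 • x.1.2)) :=
    hden'.mul hFτ
  rw [← lintegral_indicator_one hs, lintegral_map hFm hτ, Measure.smul_apply, smul_eq_mul,
    lintegral_withDensity_eq_lintegral_mul _ hden' hFτ]
  simp only [Pi.mul_apply]
  rw [lintegral_prod_symm' _ hint]
  have hinner : ∀ t ∈ Set.Ioc (0 : ℝ) 1,
      ∫⁻ q, (moderateRegion α θ).indicator (fun q ↦ ‖q.2‖ₑ ^ 4) q * F (q.1 + h t • q.2)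
        ∂((isoGaussian σ θ).prod (isoGaussian σ 0)) ≤
      ENNReal.ofReal (Real.exp (2 / σ ^ 2)) *
        (∫⁻ z : EuclideanSpace ℝ (Fin n), ‖z‖ₑ ^ 4 ∂(isoGaussian σ 0)) * isoGaussian σ θ s := by
    intro t ht
    have hint_t : Measurable (fun q : EuclideanSpace ℝ (Fin n) × EuclideanSpace ℝ (Fin n) ↦
        (moderateRegion α θ).indicator (fun q ↦ ‖q.2‖ₑ ^ 4) q * F (q.1 + h t • q.2)) :=
      hden.mul (hFm.comp (measurable_fst.add (measurable_snd.const_smul (h t))))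
    rw [lintegral_prod_symm' _ hint_t]
    have hconst : (∫⁻ z : EuclideanSpace ℝ (Fin n), ‖z‖ₑ ^ 4 *
        (ENNReal.ofReal (Real.exp (2 / σ ^ 2)) * isoGaussian σ θ s) ∂(isoGaussian σ 0)) =
        ENNReal.ofReal (Real.exp (2 / σ ^ 2)) *
        (∫⁻ z : EuclideanSpace ℝ (Fin n), ‖z‖ₑ ^ 4 ∂(isoGaussian σ 0)) * isoGaussian σ θ s := by
      rw [lintegral_mul_const _ (measurable_enorm.pow_const 4)]
      ring
    rw [← hconst]
    refine lintegral_mono fun z ↦ ?_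
    have h1 := lintegral_indicator_shift_le hσ θ z hα hα1 (hh t ht).1 (hh t ht).2 hFm
    rw [hF, lintegral_indicator_one hs] at h1
    calc _ = ∫⁻ y, ‖z‖ₑ ^ 4 * {y | α * ‖y - θ‖ ^ 4 ≤ 1 ∧ α * ‖z‖ ^ 4 ≤ 1}.indicator
            (fun y ↦ F (y + h t • z)) y ∂(isoGaussian σ θ) := by
          refine lintegral_congr fun y ↦ ?_
          by_cases hy : α * ‖y - θ‖ ^ 4 ≤ 1 ∧ α * ‖z‖ ^ 4 ≤ 1
          · rw [Set.indicator_of_mem (show (y, z) ∈ moderateRegion α θ from hy),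
              Set.indicator_of_mem (show y ∈ {y | α * ‖y - θ‖ ^ 4 ≤ 1 ∧ α * ‖z‖ ^ 4 ≤ 1} from hy)]
          · rw [Set.indicator_of_notMem (show (y, z) ∉ moderateRegion α θ from hy),
              Set.indicator_of_notMem (show y ∉ {y | α * ‖y - θ‖ ^ 4 ≤ 1 ∧ α * ‖z‖ ^ 4 ≤ 1} from hy)]
            simp
      _ = ‖z‖ₑ ^ 4 * ∫⁻ y, {y | α * ‖y - θ‖ ^ 4 ≤ 1 ∧ α * ‖z‖ ^ 4 ≤ 1}.indicator
            (fun y ↦ F (y + h t • z)) y ∂(isoGaussian σ θ) :=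
          lintegral_const_mul' _ _ (by finiteness)
      _ ≤ ‖z‖ₑ ^ 4 * (ENNReal.ofReal (Real.exp (2 / σ ^ 2)) * isoGaussian σ θ s) := by gcongr
  calc _ ≤ ∫⁻ t in Set.Ioc (0 : ℝ) 1, ENNReal.ofReal (Real.exp (2 / σ ^ 2)) *
        (∫⁻ z : EuclideanSpace ℝ (Fin n), ‖z‖ₑ ^ 4 ∂(isoGaussian σ 0)) * isoGaussian σ θ s :=
        setLIntegral_mono' measurableSet_Ioc hinner
    _ = _ := by simp

/-- Along the moderate region, the `L²` modulus of continuity of a Gaussian `L²` function tends to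
zero under vanishing shifts. -/
theorem tendsto_eLpNorm_shift_sub_moderateRegion (hσ : 0 < σ) (θ : EuclideanSpace ℝ (Fin n))
    {V : Type*} [NormedAddCommGroup V] [NormedSpace ℝ V]
    [SecondCountableTopology V] [MeasurableSpace V] [BorelSpace V]
    {F : EuclideanSpace ℝ (Fin n) → V} (hF : Measurable F) (hF2 : MemLp F 2 (isoGaussian σ θ)) :
    Tendsto (fun α ↦ ∫⁻ q in moderateRegion α θ, ‖q.2‖ₑ ^ 4 *
        (∫⁻ t in Set.Ioc (0 : ℝ) 1, ‖F (q.1 + (t * √α) • q.2) - F q.1‖ₑ ^ 2)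
        ∂((isoGaussian σ θ).prod (isoGaussian σ 0))) (𝓝[>] 0) (𝓝 0) := by
  set μ := ((isoGaussian σ θ).prod (isoGaussian σ (0 : EuclideanSpace ℝ (Fin n)))).prod
    (volume.restrict (Set.Ioc (0 : ℝ) 1)) with hμ
  have hfin : IsFiniteMeasure (μ.withDensity fun x ↦ ‖x.1.2‖ₑ ^ 4) := by
    refine isFiniteMeasure_withDensity (ne_of_lt ?_)
    rw [hμ, lintegral_prod _ (by fun_prop)]
    simp only [lintegral_const, Measure.restrict_apply_univ, Real.volume_Ioc, sub_zero,
      ENNReal.ofReal_one, mul_one]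
    rw [lintegral_prod _ (by fun_prop)]
    simp only [lintegral_const, measure_univ, mul_one]
    exact lintegral_enorm_pow_isoGaussian_lt_top 4
  have hC : ENNReal.ofReal (Real.exp (2 / σ ^ 2)) *
        ∫⁻ z : EuclideanSpace ℝ (Fin n), ‖z‖ₑ ^ 4 ∂(isoGaussian σ 0) ≠ ⊤ :=
    ENNReal.mul_ne_top ENNReal.ofReal_ne_top (lintegral_enorm_pow_isoGaussian_lt_top 4).ne
  have hev : ∀ᶠ α in 𝓝[>] (0 : ℝ), 0 ≤ α ∧ α ≤ 1 := by
    filter_upwards [Ioc_mem_nhdsGT (zero_lt_one' ℝ)] with α hα using ⟨hα.1.le, hα.2⟩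
  -- The segment parameter `t` becomes an extra coordinate and the weight `‖z‖⁴` a density. The
  -- cutoff moves with `α`, hence the family `ρ'` below the fixed `ρ`; the base point is written as
  -- a zero shift so that one domination lemma serves both maps.
  have key := tendsto_eLpNorm_comp_sub_comp (ρ := μ.withDensity fun x ↦ ‖x.1.2‖ₑ ^ 4)
    (ρ' := fun α ↦ μ.withDensity
      (fun x ↦ (moderateRegion α θ).indicator (fun q ↦ ‖q.2‖ₑ ^ 4) x.1))
    (τ := fun α x ↦ x.1.1 + (x.2 * √α) • x.1.2) (τ₀ := fun x ↦ x.1.1 + (0 : ℝ) • x.1.2)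
    (l := 𝓝[>] (0 : ℝ))
    (Eventually.of_forall fun α ↦ withDensity_mono (ae_of_all _ fun x ↦
      Set.indicator_le_self' (fun _ _ ↦ zero_le) _))
    (fun α ↦ by fun_prop) (by fun_prop) (fun x ↦ ?_) hC
    (by
      filter_upwards [hev] with α hα
      refine map_withDensity_moderateRegion_le hσ θ hα.1 hα.2 (h := fun t ↦ t * √α) (by fun_prop)
        fun t ht ↦ ⟨mul_nonneg ht.1.le (Real.sqrt_nonneg _), ?_⟩
      exact mul_le_of_le_one_left (Real.sqrt_nonneg _) ht.2)
    (by
      filter_upwards [hev] with α hα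
      exact map_withDensity_moderateRegion_le hσ θ hα.1 hα.2 (h := fun t ↦ 0) (by fun_prop)
        fun t ht ↦ ⟨le_rfl, Real.sqrt_nonneg _⟩)
    one_le_two (by simp) hF hF2
  · have h2 := (ENNReal.continuous_pow 2).tendsto 0 |>.comp key
    simp only [ne_eq, OfNat.ofNat_ne_zero, not_false_eq_true, zero_pow] at h2
    refine h2.congr fun α ↦ ?_
    have hm1 : Measurable fun x : (EuclideanSpace ℝ (Fin n) × EuclideanSpace ℝ (Fin n)) × ℝ ↦
        ‖F (x.1.1 + (x.2 * √α) • x.1.2) - F x.1.1‖ₑ ^ 2 :=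
      (((hF.comp (by fun_prop)).sub (hF.comp (by fun_prop))).enorm.pow_const 2)
    have hden : Measurable fun x : (EuclideanSpace ℝ (Fin n) × EuclideanSpace ℝ (Fin n)) × ℝ ↦
        (moderateRegion α θ).indicator (fun q ↦ ‖q.2‖ₑ ^ 4) x.1 :=
      (((by fun_prop : Measurable fun q : EuclideanSpace ℝ (Fin n) × EuclideanSpace ℝ (Fin n) ↦
        ‖q.2‖ₑ ^ 4).indicator (measurableSet_moderateRegion α θ))).comp measurable_fst
    simp only [Function.comp_apply, eLpNorm_two_pow_two, zero_smul, add_zero]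
    rw [lintegral_withDensity_eq_lintegral_mul _ hden hm1, hμ, lintegral_prod _ (hden.mul hm1).aemeasurable,
      ← lintegral_indicator (measurableSet_moderateRegion α θ)]
    refine lintegral_congr fun q ↦ ?_
    simp only [Pi.mul_apply]
    by_cases hq : q ∈ moderateRegion α θ
    · simp only [Set.indicator_of_mem hq]
      exact lintegral_const_mul' _ _ (by finiteness)
    · simp [Set.indicator_of_notMem hq]
  · have : Continuous fun α : ℝ ↦ x.1.1 + (x.2 * √α) • x.1.2 := by fun_prop
    have h2 := (this.tendsto 0).mono_left (nhdsWithin_le_nhds (s := Set.Ioi 0))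
    simpa using h2

end GaussianJacobian

/-! ### Convergence of the directional difference quotient. -/

section DirectionalDerivative

open scoped ENNReal RealInnerProductSpace

variable {n : ℕ} {σ : ℝ} {θ : EuclideanSpace ℝ (Fin n)}
  {g : EuclideanSpace ℝ (Fin n) → EuclideanSpace ℝ (Fin n)}
  {G : EuclideanSpace ℝ (Fin n) → Fin n → Fin n → ℝ}

/-- Carries the Lebesgue-a.e. line-integral identity over to Gaussian pairs `(y, c z)`. -/
theorem quasiMeasurePreserving_prod_smul (hσ : 0 < σ) (θ : EuclideanSpace ℝ (Fin n)) {c : ℝ}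
    (hc : c ≠ 0) :
    Measure.QuasiMeasurePreserving
      (fun q : EuclideanSpace ℝ (Fin n) × EuclideanSpace ℝ (Fin n) ↦ (q.1, c • q.2))
      ((isoGaussian σ θ).prod (isoGaussian σ 0)) volume := by
  have h1 : Measure.QuasiMeasurePreserving (fun z : EuclideanSpace ℝ (Fin n) ↦ c • z) := by
    refine ⟨by fun_prop, ?_⟩
    rw [Measure.map_addHaar_smul volume hc]
    exact Measure.smul_absolutelyContinuous
  have h2 : Measure.QuasiMeasurePreserving
      (fun q : EuclideanSpace ℝ (Fin n) × EuclideanSpace ℝ (Fin n) ↦ (q.1, c • q.2))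
      (volume.prod volume) (volume.prod volume) := by
    refine ⟨by fun_prop, ?_⟩
    have := Measure.map_prod_map (volume : Measure (EuclideanSpace ℝ (Fin n)))
      (volume : Measure (EuclideanSpace ℝ (Fin n))) measurable_id h1.measurable
    rw [Measure.map_id] at this
    change Measure.map (Prod.map id _) _ ≪ _
    rw [← this]
    exact Measure.AbsolutelyContinuous.rfl.prod h1.absolutelyContinuous
  exact h2.mono_left ((isoGaussian_absolutelyContinuous hσ θ).prod
    (isoGaussian_absolutelyContinuous hσ 0))

theorem HasWeakJacobian.ae_sub_eq_integral (hG : HasWeakJacobian g G) (hσ : 0 < σ)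
    (θ : EuclideanSpace ℝ (Fin n)) {α : ℝ} (hα : 0 < α) :
    ∀ᵐ q ∂((isoGaussian σ θ).prod (isoGaussian σ 0)), ∀ i,
      IntervalIntegrable (fun t ↦ ∑ j, q.2 j * G (q.1 + (t * √α) • q.2) i j) volume 0 1 ∧
      g (q.1 + √α • q.2) i - g q.1 i =
        √α * ∫ t in (0 : ℝ)..1, ∑ j, q.2 j * G (q.1 + (t * √α) • q.2) i j := by
  have hs : √α ≠ 0 := (Real.sqrt_pos.2 hα).ne'
  rw [ae_all_iff]
  intro i
  filter_upwards [(quasiMeasurePreserving_prod_smul hσ θ hs).ae (hG.ae_line_integral i)] with q hq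
  have e : (fun t : ℝ ↦ ∑ j, (√α • q.2) j * G (q.1 + t • √α • q.2) i j) =
      fun t ↦ √α * ∑ j, q.2 j * G (q.1 + (t * √α) • q.2) i j := by
    funext t
    rw [Finset.mul_sum]
    simp [mul_assoc, smul_smul]
  rw [e] at hq
  refine ⟨?_, ?_⟩
  · have := hq.1.const_mul (√α)⁻¹
    simpa [← mul_assoc, inv_mul_cancel₀ hs] using this
  · rw [hq.2, ← intervalIntegral.integral_const_mul]

theorem abs_sum_mul_le (z : EuclideanSpace ℝ (Fin n)) (A : Fin n → Fin n → ℝ) (i : Fin n) :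
    ‖∑ j, z j * A i j‖ ≤ n * ‖z‖ * ‖A‖ := by
  calc ‖∑ j, z j * A i j‖ ≤ ∑ j : Fin n, ‖z‖ * ‖A‖ := by
        refine norm_sum_le_of_le _ fun j _ ↦ ?_
        rw [norm_mul]
        gcongr
        · exact PiLp.norm_apply_le z j
        · exact (norm_le_pi_norm (A i) j).trans (norm_le_pi_norm A i)
    _ = n * ‖z‖ * ‖A‖ := by simp; ring

theorem abs_quadForm_le (z : EuclideanSpace ℝ (Fin n)) (A : Fin n → Fin n → ℝ) :
    ‖quadForm A z‖ ≤ n ^ 2 * ‖z‖ ^ 2 * ‖A‖ := by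
  calc ‖quadForm A z‖ ≤ ∑ i : Fin n, ‖z‖ * (n * ‖z‖ * ‖A‖) := by
        refine norm_sum_le_of_le _ fun i _ ↦ ?_
        rw [norm_mul]
        gcongr
        · exact PiLp.norm_apply_le z i
        · exact abs_sum_mul_le z A i
    _ = n ^ 2 * ‖z‖ ^ 2 * ‖A‖ := by simp; ring

/-- The difference quotient is the average over the segment of the quadratic form of `G`;
subtracting the constant `G q.1` inside the average leaves only the oscillation of `G` along the
segment. -/
theorem enorm_difference_quotient_sub_quadForm_le {α : ℝ} (hα : 0 < α)
    {q : EuclideanSpace ℝ (Fin n) × EuclideanSpace ℝ (Fin n)}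
    (hq : ∀ i, IntervalIntegrable (fun t ↦ ∑ j, q.2 j * G (q.1 + (t * √α) • q.2) i j) volume 0 1 ∧
      g (q.1 + √α • q.2) i - g q.1 i =
        √α * ∫ t in (0 : ℝ)..1, ∑ j, q.2 j * G (q.1 + (t * √α) • q.2) i j) :
    ‖1 / √α * ⟪q.2, g (q.1 + √α • q.2) - g q.1⟫ - quadForm (G q.1) q.2‖ₑ ≤
      n ^ 2 * ‖q.2‖ₑ ^ 2 *
        ∫⁻ t in Set.Ioc (0 : ℝ) 1, ‖G (q.1 + (t * √α) • q.2) - G q.1‖ₑ := by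
  have hs : √α ≠ 0 := (Real.sqrt_pos.2 hα).ne'
  have e : 1 / √α * ⟪q.2, g (q.1 + √α • q.2) - g q.1⟫ - quadForm (G q.1) q.2 =
      ∑ i, q.2 i * ∫ t in Set.Ioc (0 : ℝ) 1,
        ∑ j, q.2 j * (G (q.1 + (t * √α) • q.2) - G q.1) i j := by
    have h1 : ∀ i, ∫ t in Set.Ioc (0 : ℝ) 1,
        ∑ j, q.2 j * (G (q.1 + (t * √α) • q.2) - G q.1) i j =
        1 / √α * (g (q.1 + √α • q.2) - g q.1) i - ∑ j, q.2 j * G q.1 i j := by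
      intro i
      rw [← intervalIntegral.integral_of_le zero_le_one]
      simp only [Pi.sub_apply, mul_sub, Finset.sum_sub_distrib]
      rw [intervalIntegral.integral_sub (hq i).1 (by simp), PiLp.sub_apply, (hq i).2]
      rw [← mul_assoc, one_div_mul_cancel hs, one_mul]
      simp
    simp_rw [h1, mul_sub, Finset.sum_sub_distrib]
    rw [quadForm, PiLp.inner_apply, Finset.mul_sum]
    congr 1
    refine Finset.sum_congr rfl fun i _ ↦ ?_
    simp
    ring
  rw [e]
  have h2 : ∀ (B : Fin n → Fin n → ℝ) (i : Fin n),
      ‖∑ j, q.2 j * B i j‖ₑ ≤ n * ‖q.2‖ₑ * ‖B‖ₑ := by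
    intro B i
    have := abs_sum_mul_le q.2 B i
    rw [← ofReal_norm, ← ofReal_norm, ← ofReal_norm, ← ENNReal.ofReal_natCast,
      ← ENNReal.ofReal_mul (by positivity), ← ENNReal.ofReal_mul (by positivity)]
    exact ENNReal.ofReal_le_ofReal this
  calc _ ≤ ∑ i, ‖q.2 i * ∫ t in Set.Ioc (0 : ℝ) 1,
        ∑ j, q.2 j * (G (q.1 + (t * √α) • q.2) - G q.1) i j‖ₑ := enorm_sum_le _ _
    _ ≤ ∑ i : Fin n, ‖q.2‖ₑ * (n * ‖q.2‖ₑ *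
          ∫⁻ t in Set.Ioc (0 : ℝ) 1, ‖G (q.1 + (t * √α) • q.2) - G q.1‖ₑ) := by
        refine Finset.sum_le_sum fun i _ ↦ ?_
        rw [enorm_mul]
        gcongr
        · rw [← ofReal_norm, ← ofReal_norm]
          exact ENNReal.ofReal_le_ofReal (PiLp.norm_apply_le q.2 i)
        · refine (enorm_integral_le_lintegral_enorm _).trans ?_
          rw [← lintegral_const_mul' _ _ (by finiteness)]
          exact lintegral_mono fun t ↦ h2 _ i
    _ = _ := by simp; ring

theorem sq_lintegral_enorm_Ioc_le {V : Type*} [NormedAddCommGroup V] {f : ℝ → V}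
    (hf : AEStronglyMeasurable f (volume.restrict (Set.Ioc (0 : ℝ) 1))) :
    (∫⁻ t in Set.Ioc (0 : ℝ) 1, ‖f t‖ₑ) ^ 2 ≤ ∫⁻ t in Set.Ioc (0 : ℝ) 1, ‖f t‖ₑ ^ 2 := by
  have : IsProbabilityMeasure (volume.restrict (Set.Ioc (0 : ℝ) 1)) := ⟨by simp⟩
  have h := eLpNorm_le_eLpNorm_of_exponent_le (p := 1) (q := 2) one_le_two hf
  rw [eLpNorm_one_eq_lintegral_enorm] at h
  rw [← eLpNorm_two_pow_two]
  gcongr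

theorem memLp_quadForm (hGm : Measurable G) (hG2 : MemLp G 2 (isoGaussian σ θ)) :
    MemLp (fun q : EuclideanSpace ℝ (Fin n) × EuclideanSpace ℝ (Fin n) ↦ quadForm (G q.1) q.2) 2
      ((isoGaussian σ θ).prod (isoGaussian σ 0)) := by
  have hm : Measurable (fun q : EuclideanSpace ℝ (Fin n) × EuclideanSpace ℝ (Fin n) ↦
      quadForm (G q.1) q.2) := by
    unfold quadForm; fun_prop
  refine ⟨hm.aestronglyMeasurable, ?_⟩
  have h6 : eLpNorm G 2 (isoGaussian σ θ) ^ 2 < ⊤ := ENNReal.pow_lt_top hG2.2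
  rw [eLpNorm_two_pow_two] at h6
  rw [← (ENNReal.pow_lt_top_iff (n := 2)).trans (or_iff_left two_ne_zero), eLpNorm_two_pow_two]
  calc _ ≤ ∫⁻ q : EuclideanSpace ℝ (Fin n) × EuclideanSpace ℝ (Fin n),
        ‖G q.1‖ₑ ^ 2 * ((n : ℝ≥0∞) ^ 4 * ‖q.2‖ₑ ^ 4) ∂((isoGaussian σ θ).prod (isoGaussian σ 0)) := by
        refine lintegral_mono fun q ↦ ?_
        have := abs_quadForm_le q.2 (G q.1)
        have h5 : ‖quadForm (G q.1) q.2‖ₑ ≤ n ^ 2 * ‖q.2‖ₑ ^ 2 * ‖G q.1‖ₑ := by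
          rw [← ofReal_norm, ← ofReal_norm, ← ofReal_norm, ← ENNReal.ofReal_natCast,
            ← ENNReal.ofReal_pow (by positivity), ← ENNReal.ofReal_pow (by positivity),
            ← ENNReal.ofReal_mul (by positivity), ← ENNReal.ofReal_mul (by positivity)]
          exact ENNReal.ofReal_le_ofReal this
        calc _ ≤ (n ^ 2 * ‖q.2‖ₑ ^ 2 * ‖G q.1‖ₑ) ^ 2 := by gcongr
          _ = _ := by ring
    _ = (∫⁻ y, ‖G y‖ₑ ^ 2 ∂(isoGaussian σ θ)) *
        ∫⁻ z : EuclideanSpace ℝ (Fin n), (n : ℝ≥0∞) ^ 4 * ‖z‖ₑ ^ 4 ∂(isoGaussian σ 0) :=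
        lintegral_prod_mul (hGm.enorm.pow_const 2).aemeasurable
          ((measurable_enorm.pow_const 4).const_mul _).aemeasurable
    _ < ⊤ := by
        rw [lintegral_const_mul _ (by fun_prop)]
        refine ENNReal.mul_lt_top h6 (ENNReal.mul_lt_top (by finiteness) ?_)
        exact lintegral_enorm_pow_isoGaussian_lt_top 4

/-- Squaring the oscillation bound and applying Cauchy–Schwarz in `t` gives `n⁴` times the `L²`
modulus of continuity of `G` with weight `‖z‖⁴`. -/
theorem tendsto_eLpNorm_difference_quotient_moderateRegion (hσ : 0 < σ)
    (θ : EuclideanSpace ℝ (Fin n)) (hGm : Measurable G)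
    (hG : HasWeakJacobian g G) (hG2 : MemLp G 2 (isoGaussian σ θ)) :
    Tendsto (fun α ↦ eLpNorm ((moderateRegion α θ).indicator fun q ↦
        1 / √α * ⟪q.2, g (q.1 + √α • q.2) - g q.1⟫ - quadForm (G q.1) q.2) 2
        ((isoGaussian σ θ).prod (isoGaussian σ 0))) (𝓝[>] 0) (𝓝 0) := by
  have h1 := tendsto_eLpNorm_shift_sub_moderateRegion hσ θ hGm hG2
  have h2 := (ENNReal.Tendsto.const_mul (a := (n : ℝ≥0∞) ^ 4) h1 (Or.inr (by finiteness))).ennrpow_const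
    (1 / 2)
  rw [mul_zero, ENNReal.zero_rpow_of_pos (by norm_num)] at h2
  refine tendsto_of_tendsto_of_tendsto_of_le_of_le' tendsto_const_nhds h2
    (Eventually.of_forall fun _ ↦ zero_le) ?_
  filter_upwards [self_mem_nhdsWithin] with α hα
  rw [eLpNorm_eq_lintegral_rpow_enorm_toReal (by simp) (by simp)]
  simp only [ENNReal.toReal_ofNat]
  refine ENNReal.rpow_le_rpow ?_ (by norm_num)
  rw [← lintegral_const_mul' _ _ (by finiteness),
    ← lintegral_indicator (measurableSet_moderateRegion α θ)]
  refine lintegral_mono_ae ?_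
  filter_upwards [hG.ae_sub_eq_integral hσ θ hα] with q hq
  by_cases hqB : q ∈ moderateRegion α θ
  swap
  · simp [Set.indicator_of_notMem hqB]
  rw [Set.indicator_of_mem hqB, Set.indicator_of_mem hqB, ENNReal.rpow_ofNat]
  calc _ ≤ (n ^ 2 * ‖q.2‖ₑ ^ 2 *
        ∫⁻ t in Set.Ioc (0 : ℝ) 1, ‖G (q.1 + (t * √α) • q.2) - G q.1‖ₑ) ^ 2 := by
        gcongr; exact enorm_difference_quotient_sub_quadForm_le hα hq
    _ = n ^ 4 * (‖q.2‖ₑ ^ 4 *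
        (∫⁻ t in Set.Ioc (0 : ℝ) 1, ‖G (q.1 + (t * √α) • q.2) - G q.1‖ₑ) ^ 2) := by ring
    _ ≤ _ := by
        gcongr
        refine sq_lintegral_enorm_Ioc_le ?_
        exact ((hGm.comp (by fun_prop)).sub measurable_const).aestronglyMeasurable

/-- The directional difference quotient of `g` along Gaussian noise converges in `L²` to the
quadratic form of its weak Jacobian. -/
theorem tendsto_eLpNorm_difference_quotient (hσ : 0 < σ)
    (θ : EuclideanSpace ℝ (Fin n)) {α₀ : ℝ} (hα₀ : 0 < α₀) (hg : Measurable g) (hGm : Measurable G)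
    (hG : HasWeakJacobian g G) (hG2 : MemLp G 2 (isoGaussian σ θ))
    (hg4 : MemLp g 4 (isoGaussian (σ * √(1 + α₀)) θ)) :
    Tendsto (fun α ↦ eLpNorm (fun q ↦
        1 / √α * ⟪q.2, g (q.1 + √α • q.2) - g q.1⟫ - quadForm (G q.1) q.2) 2
        ((isoGaussian σ θ).prod (isoGaussian σ 0))) (𝓝[>] 0) (𝓝 0) := by
  set μ := (isoGaussian σ θ).prod (isoGaussian σ (0 : EuclideanSpace ℝ (Fin n))) with hμ
  have h1 := tendsto_eLpNorm_difference_quotient_moderateRegion hσ θ hGm hG hG2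
  have h2 := tendsto_eLpNorm_indicator_compl_moderateRegion θ (memLp_quadForm hGm hG2)
  have h3 := tendsto_eLpNorm_perturb_sub hσ hα₀ θ hg (by norm_num) (by simp) hg4
  have hW := memLp_norm_pow_isoGaussian_prod (σ := σ) θ
  have h4 := ENNReal.Tendsto.const_mul h3 (Or.inr hW.2.ne)
  have h5 := (h1.add h4).add h2
  simp only [mul_zero, add_zero] at h5
  have hQm : Measurable (fun q : EuclideanSpace ℝ (Fin n) × EuclideanSpace ℝ (Fin n) ↦
      quadForm (G q.1) q.2) := by
    unfold quadForm; fun_prop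
  refine tendsto_of_tendsto_of_tendsto_of_le_of_le' tendsto_const_nhds h5
    (Eventually.of_forall fun _ ↦ zero_le) ?_
  filter_upwards [self_mem_nhdsWithin] with α (hα : 0 < α)
  have hB := measurableSet_moderateRegion α θ
  have hΔm : Measurable (fun q : EuclideanSpace ℝ (Fin n) × EuclideanSpace ℝ (Fin n) ↦
      g (q.1 + √α • q.2) - g q.1) := (hg.comp (by fun_prop)).sub (hg.comp measurable_fst)
  have hDm : Measurable (fun q : EuclideanSpace ℝ (Fin n) × EuclideanSpace ℝ (Fin n) ↦
      1 / √α * ⟪q.2, g (q.1 + √α • q.2) - g q.1⟫) :=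
    (measurable_snd.inner hΔm).const_mul _
  -- The Jacobian identity is used only inside the region; outside, the quotient and the quadratic
  -- form are each small on their own.
  have e : (fun q : EuclideanSpace ℝ (Fin n) × EuclideanSpace ℝ (Fin n) ↦
      1 / √α * ⟪q.2, g (q.1 + √α • q.2) - g q.1⟫ - quadForm (G q.1) q.2) =
      (((moderateRegion α θ).indicator fun q ↦
        1 / √α * ⟪q.2, g (q.1 + √α • q.2) - g q.1⟫ - quadForm (G q.1) q.2) +
      ((moderateRegion α θ)ᶜ.indicator fun q ↦ 1 / √α * ⟪q.2, g (q.1 + √α • q.2) - g q.1⟫)) -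
      (moderateRegion α θ)ᶜ.indicator fun q ↦ quadForm (G q.1) q.2 := by
    funext q
    by_cases hq : q ∈ moderateRegion α θ <;> simp [hq]
  have hDQm : Measurable (fun q : EuclideanSpace ℝ (Fin n) × EuclideanSpace ℝ (Fin n) ↦
      1 / √α * ⟪q.2, g (q.1 + √α • q.2) - g q.1⟫ - quadForm (G q.1) q.2) := hDm.sub hQm
  refine (congrArg (fun f ↦ eLpNorm f 2 μ) e).le.trans ?_
  refine (eLpNorm_sub_le ?_ ?_ one_le_two).trans ?_
  · exact ((hDQm.indicator hB).add (hDm.indicator hB.compl)).aestronglyMeasurable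
  · exact (hQm.indicator hB.compl).aestronglyMeasurable
  gcongr
  refine (eLpNorm_add_le (hDQm.indicator hB).aestronglyMeasurable
    (hDm.indicator hB.compl).aestronglyMeasurable one_le_two).trans ?_
  gcongr
  -- Off the region the quotient is at most `‖q - (θ, 0)‖³` times the norm of the increment of `g`,
  -- and that increment vanishes in `L⁴`.
  refine eLpNorm_two_le_mul_eLpNorm_four (V' := ℝ) hW.1 hΔm.aestronglyMeasurable (ae_of_all _ fun q ↦ ?_)
  by_cases hq : q ∈ moderateRegion α θ
  · rw [Set.indicator_of_notMem (Set.notMem_compl_iff.2 hq), norm_zero]; positivity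
  rw [Set.indicator_of_mem (Set.mem_compl hq), norm_mul, norm_pow, norm_norm, pow_succ]
  have h7 := one_div_sqrt_le_of_notMem_moderateRegion hα hq
  rw [Real.norm_of_nonneg (by positivity), mul_assoc]
  have h8 : ‖q.2‖ ≤ ‖q - (θ, 0)‖ := by
    have := norm_snd_le (q - (θ, 0))
    rwa [Prod.snd_sub, sub_zero] at this
  gcongr
  exact (norm_inner_le_norm (𝕜 := ℝ) _ _).trans (by gcongr)

end DirectionalDerivative

/-! ### `L²` limit of one summand of the estimator. -/

section CrossValidationIncrement

open scoped ENNReal RealInnerProductSpace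

variable {n : ℕ} {σ : ℝ} {θ : EuclideanSpace ℝ (Fin n)}
  {g : EuclideanSpace ℝ (Fin n) → EuclideanSpace ℝ (Fin n)}
  {G : EuclideanSpace ℝ (Fin n) → Fin n → Fin n → ℝ}

/-- The part of one summand of the cross-validated estimator, as a function of the data and the
noise, that is left after removing the terms that depend on the data only or that cancel in the
average. -/
noncomputable def cvIncrement {n : ℕ} (g : EuclideanSpace ℝ (Fin n) → EuclideanSpace ℝ (Fin n))
    (α : ℝ) (q : EuclideanSpace ℝ (Fin n) × EuclideanSpace ℝ (Fin n)) : ℝ :=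
  ‖g (q.1 + √α • q.2)‖ ^ 2 - ‖g q.1‖ ^ 2 - 2 * ⟪q.1, g (q.1 + √α • q.2) - g q.1⟫ +
    2 * (1 / √α * ⟪q.2, g (q.1 + √α • q.2) - g q.1⟫)

theorem tendsto_eLpNorm_cvIncrement (hσ : 0 < σ)
    (θ : EuclideanSpace ℝ (Fin n)) {α₀ : ℝ} (hα₀ : 0 < α₀) (hg : Measurable g) (hGm : Measurable G)
    (hG : HasWeakJacobian g G) (hG2 : MemLp G 2 (isoGaussian σ θ))
    (hg4 : MemLp g 4 (isoGaussian (σ * √(1 + α₀)) θ)) (hg4' : MemLp g 4 (isoGaussian σ θ)) :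
    Tendsto (fun α ↦ eLpNorm (fun q ↦ cvIncrement g α q - 2 * quadForm (G q.1) q.2) 2
        ((isoGaussian σ θ).prod (isoGaussian σ 0))) (𝓝[>] 0) (𝓝 0) := by
  set μ := (isoGaussian σ θ).prod (isoGaussian σ (0 : EuclideanSpace ℝ (Fin n))) with hμ
  have h1 := tendsto_eLpNorm_difference_quotient hσ θ hα₀ hg hGm hG hG2 hg4
  have h3 := tendsto_eLpNorm_perturb_sub hσ hα₀ θ hg (by norm_num) (by simp) hg4
  have hR : MemLp (fun q : EuclideanSpace ℝ (Fin n) × EuclideanSpace ℝ (Fin n) ↦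
      g q.1 - q.1) 4 μ := by
    have : MemLp (fun y ↦ g y - y) 4 (isoGaussian σ θ) :=
      hg4'.sub (IsGaussian.memLp_id _ 4 (by simp))
    exact this.comp_fst _
  have hQm : Measurable (fun q : EuclideanSpace ℝ (Fin n) × EuclideanSpace ℝ (Fin n) ↦
      quadForm (G q.1) q.2) := by
    unfold quadForm; fun_prop
  have h4 := ENNReal.Tendsto.mul h3 (Or.inr (by finiteness))
    (h3.add (tendsto_const_nhds (x := 2 * eLpNorm (fun q : EuclideanSpace ℝ (Fin n) ×
      EuclideanSpace ℝ (Fin n) ↦ g q.1 - q.1) 4 μ)))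
    (Or.inr (by simp))
  have h5 := h4.add (ENNReal.Tendsto.const_mul (a := 2) h1 (Or.inr (by simp)))
  simp only [zero_mul, mul_zero, add_zero] at h5
  refine tendsto_of_tendsto_of_tendsto_of_le_of_le' tendsto_const_nhds h5
    (Eventually.of_forall fun _ ↦ zero_le) (Eventually.of_forall fun α ↦ ?_)
  have hΔm : Measurable (fun q : EuclideanSpace ℝ (Fin n) × EuclideanSpace ℝ (Fin n) ↦
      g (q.1 + √α • q.2) - g q.1) := (hg.comp (by fun_prop)).sub (hg.comp measurable_fst)
  have hSm : Measurable (fun q : EuclideanSpace ℝ (Fin n) × EuclideanSpace ℝ (Fin n) ↦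
      g (q.1 + √α • q.2) - g q.1 + (2 : ℝ) • (g q.1 - q.1)) :=
    hΔm.add (((hg.comp measurable_fst).sub measurable_fst).const_smul (2 : ℝ))
  have hDQm : Measurable (fun q : EuclideanSpace ℝ (Fin n) × EuclideanSpace ℝ (Fin n) ↦
      1 / √α * ⟪q.2, g (q.1 + √α • q.2) - g q.1⟫ - quadForm (G q.1) q.2) :=
    ((measurable_snd.inner hΔm).const_mul _).sub hQm
  have hIm : Measurable (fun q : EuclideanSpace ℝ (Fin n) × EuclideanSpace ℝ (Fin n) ↦
      ⟪g (q.1 + √α • q.2) - g q.1, g (q.1 + √α • q.2) - g q.1 + (2 : ℝ) • (g q.1 - q.1)⟫) :=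
    hΔm.inner hSm
  -- With `Δ = g(y + √α z) - g(y)`, the terms without `1/√α` combine to `⟨Δ, Δ + 2(g(y) - y)⟩`: a
  -- factor vanishing in `L⁴` against one bounded in `L⁴`.
  have e : (fun q : EuclideanSpace ℝ (Fin n) × EuclideanSpace ℝ (Fin n) ↦
      cvIncrement g α q - 2 * quadForm (G q.1) q.2) =
      (fun q ↦ ⟪g (q.1 + √α • q.2) - g q.1,
        g (q.1 + √α • q.2) - g q.1 + (2 : ℝ) • (g q.1 - q.1)⟫) +
      (2 : ℝ) • fun q ↦ 1 / √α * ⟪q.2, g (q.1 + √α • q.2) - g q.1⟫ - quadForm (G q.1) q.2 := by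
    funext q
    simp only [cvIncrement, Pi.add_apply, Pi.smul_apply, smul_eq_mul]
    generalize g (q.1 + √α • q.2) = u
    rw [show u - g q.1 + (2 : ℝ) • (g q.1 - q.1) = u + g q.1 - (2 : ℝ) • q.1 by
      rw [smul_sub, two_smul, two_smul]; abel]
    simp only [inner_sub_left, inner_sub_right, inner_add_right, inner_smul_right,
      real_inner_self_eq_norm_sq, real_inner_comm q.1, real_inner_comm u (g q.1)]
    ring
  refine (congrArg (fun f ↦ eLpNorm f 2 μ) e).le.trans ?_
  refine (eLpNorm_add_le hIm.aestronglyMeasurable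
    (hDQm.aestronglyMeasurable.const_smul (2 : ℝ)) one_le_two).trans ?_
  gcongr
  · refine (eLpNorm_two_le_mul_eLpNorm_four (V' := ℝ) hΔm.aestronglyMeasurable
      hSm.aestronglyMeasurable (ae_of_all _ fun q ↦ norm_inner_le_norm (𝕜 := ℝ) _ _)).trans ?_
    gcongr
    refine (eLpNorm_add_le hΔm.aestronglyMeasurable (hR.1.const_smul (2 : ℝ)) (by norm_num)).trans ?_
    gcongr
    refine (eLpNorm_const_smul_le (c := (2 : ℝ))).trans ?_
    gcongr
    simp [enorm_eq_nnnorm]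
  · refine (eLpNorm_const_smul_le (c := (2 : ℝ))).trans ?_
    gcongr
    simp [enorm_eq_nnnorm]

end CrossValidationIncrement

/-! ### Fourth moments of Gaussian vectors. -/

section GaussianMoments

open scoped ENNReal NNReal

/-- The moment is the fourth derivative at zero of the moment generating function `exp(v t² / 2)`.
-/
theorem integral_pow_four_gaussianReal (v : ℝ≥0) :
    ∫ x, x ^ 4 ∂(gaussianReal 0 v) = 3 * (v : ℝ) ^ 2 := by
  have h := iteratedDeriv_mgf_zero (X := id) (μ := gaussianReal 0 v)
    (by simp [integrableExpSet_id_gaussianReal]) 4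
  have e : ∀ t : ℝ, HasDerivAt (fun t : ℝ ↦ Real.exp (v * t ^ 2 / 2))
      (v * t * Real.exp (v * t ^ 2 / 2)) t := by
    intro t
    have h1 : HasDerivAt (fun t : ℝ ↦ v * t ^ 2 / 2) (v * t) t := by
      have := ((hasDerivAt_pow 2 t).const_mul (v : ℝ)).div_const 2
      exact this.congr_deriv (by push_cast; ring)
    exact h1.exp.congr_deriv (by ring)
  have d : ∀ (p p' : ℝ → ℝ), (∀ t, HasDerivAt p (p' t) t) →
      deriv (fun t : ℝ ↦ p t * Real.exp (v * t ^ 2 / 2)) =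
        fun t ↦ (p' t + p t * (v * t)) * Real.exp (v * t ^ 2 / 2) := by
    intro p p' hp
    funext t
    exact ((hp t).mul (e t)).deriv.trans (by ring)
  have d1 : deriv (fun t : ℝ ↦ Real.exp (v * t ^ 2 / 2)) =
      fun t ↦ (v * t) * Real.exp (v * t ^ 2 / 2) := funext fun t ↦ (e t).deriv
  have hlin : ∀ t : ℝ, HasDerivAt (fun t : ℝ ↦ (v : ℝ) * t) v t := fun t ↦ by
    simpa using (hasDerivAt_id t).const_mul (v : ℝ)
  have d2 := d _ _ hlin
  have hq : ∀ t : ℝ, HasDerivAt (fun t : ℝ ↦ (v : ℝ) + v * t * (v * t)) (2 * v ^ 2 * t) t := by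
    intro t
    have := ((hlin t).mul (hlin t)).const_add (v : ℝ)
    exact this.congr_deriv (by ring)
  have d3 := d _ _ hq
  have hc : ∀ t : ℝ, HasDerivAt (fun t : ℝ ↦ 2 * (v : ℝ) ^ 2 * t + (v + v * t * (v * t)) * (v * t))
      (2 * (v : ℝ) ^ 2 + (2 * (v : ℝ) ^ 2 * t * (v * t) + (v + v * t * (v * t)) * v)) t := by
    intro t
    have h1 : HasDerivAt (fun t : ℝ ↦ 2 * (v : ℝ) ^ 2 * t) (2 * (v : ℝ) ^ 2) t := by
      simpa using (hasDerivAt_id t).const_mul (2 * (v : ℝ) ^ 2)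
    exact h1.add ((hq t).mul (hlin t))
  have d4 := d _ _ hc
  rw [mgf_id_gaussianReal] at h
  simp only [zero_mul, zero_add] at h
  rw [iteratedDeriv_succ, iteratedDeriv_succ, iteratedDeriv_succ, iteratedDeriv_one, d1, d2, d3,
    d4] at h
  simp only [Pi.pow_apply, id_eq] at h
  rw [← h]
  simp
  ring

variable {Ω : Type*} [MeasurableSpace Ω] {P : Measure Ω}

theorem HasGaussianLaw.integral_pow_four {S : Ω → ℝ} (hS : HasGaussianLaw S P)
    (h0 : ∫ w, S w ∂P = 0) : ∫ w, S w ^ 4 ∂P = 3 * (∫ w, S w ^ 2 ∂P) ^ 2 := by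
  have h1 : ∫ w, S w ^ 4 ∂P = ∫ x, x ^ 4 ∂(P.map S) := by
    rw [integral_map hS.aemeasurable (by fun_prop)]
  have h2 : Var[S; P] = ∫ w, S w ^ 2 ∂P := by
    rw [variance_of_integral_eq_zero hS.aemeasurable h0]
  rw [h1, hS.map_eq_gaussianReal, h0, integral_pow_four_gaussianReal,
    Real.coe_toNNReal _ (variance_nonneg _ _), h2]

theorem HasGaussianLaw.memLp_eval {ι : Type*} [Finite ι] {X : ι → Ω → ℝ}
    (hX : HasGaussianLaw (fun w i ↦ X i w) P) (i : ι) {p : ℝ≥0∞} (hp : p ≠ ⊤) : MemLp (X i) p P :=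
  (hX.eval i).memLp hp

/-- Isserlis' formula for the fourth mixed moment of a centred Gaussian vector. -/
theorem HasGaussianLaw.integral_mul_mul_mul {ι : Type*} [Finite ι] {X : ι → Ω → ℝ}
    (hX : HasGaussianLaw (fun w i ↦ X i w) P) (h0 : ∀ i, ∫ w, X i w ∂P = 0) (i j k l : ι) :
    ∫ w, X i w * X j w * (X k w * X l w) ∂P =
      (∫ w, X i w * X j w ∂P) * (∫ w, X k w * X l w ∂P) +
      (∫ w, X i w * X k w ∂P) * (∫ w, X j w * X l w ∂P) +
      (∫ w, X i w * X l w ∂P) * (∫ w, X j w * X k w ∂P) := by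
  have := Fintype.ofFinite ι
  have hPm : IsProbabilityMeasure P := hX.isProbabilityMeasure
  set I : Fin 4 → ι := ![i, j, k, l] with hI
  -- All sign patterns with first sign `+`; the other eight repeat the same fourth powers.
  set c : Fin 8 → Fin 4 → ℝ := ![![1, 1, 1, 1], ![1, 1, 1, -1], ![1, 1, -1, 1], ![1, 1, -1, -1],
    ![1, -1, 1, 1], ![1, -1, 1, -1], ![1, -1, -1, 1], ![1, -1, -1, -1]] with hc
  have hint2 : ∀ a b, Integrable (fun w ↦ X a w * X b w) P := fun a b ↦
    (memLp_eval hX a (p := 2) (by simp)).integrable_mul (memLp_eval hX b (p := 2) (by simp))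
  have hG : ∀ e, HasGaussianLaw (fun w ↦ ∑ a, c e a * X (I a) w) P := by
    intro e
    have := hX.map_fun (∑ a, c e a • (ContinuousLinearMap.proj (I a) : (ι → ℝ) →L[ℝ] ℝ))
    simpa using this
  have hG0 : ∀ e, ∫ w, ∑ a, c e a * X (I a) w ∂P = 0 := by
    intro e
    rw [integral_finsetSum _ fun a _ ↦
      (((memLp_eval hX (I a) (p := 1) (by simp)).integrable le_rfl).const_mul _)]
    simp [integral_const_mul, h0]
  have hG2 : ∀ e, ∫ w, (∑ a, c e a * X (I a) w) ^ 2 ∂P =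
      ∑ a, ∑ b, c e a * c e b * ∫ w, X (I a) w * X (I b) w ∂P := by
    intro e
    have h1 : ∀ w, (∑ a, c e a * X (I a) w) ^ 2 =
        ∑ a, ∑ b, c e a * c e b * (X (I a) w * X (I b) w) := by
      intro w
      rw [sq, Finset.sum_mul_sum]
      refine Finset.sum_congr rfl fun a _ ↦ Finset.sum_congr rfl fun b _ ↦ by ring
    simp_rw [h1]
    rw [integral_finsetSum _ fun a _ ↦ integrable_finsetSum _ fun b _ ↦ (hint2 _ _).const_mul _]
    refine Finset.sum_congr rfl fun a _ ↦ ?_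
    rw [integral_finsetSum _ fun b _ ↦ (hint2 _ _).const_mul _]
    simp_rw [integral_const_mul]
  have hG4 : ∀ e, Integrable (fun w ↦ (∑ a, c e a * X (I a) w) ^ 4) P := by
    intro e
    have := ((hG e).memLp (p := 4) (by simp)).integrable_norm_pow (by norm_num)
    refine this.congr (ae_of_all _ fun w ↦ ?_)
    simp only [Real.norm_eq_abs]
    exact Even.pow_abs (by decide) _
  -- Polarization: the signed sum of fourth powers cancels every monomial except the mixed one,
  -- whose coefficient is `4! * 8 = 192`. The mixed moment thus reduces to fourth moments of
  -- one-dimensional Gaussians.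
  have key : ∀ w, X i w * X j w * (X k w * X l w) =
      ∑ e, (1 / 192 * (c e 1 * c e 2 * c e 3)) * (∑ a, c e a * X (I a) w) ^ 4 := by
    intro w
    simp only [Fin.sum_univ_eight, Fin.sum_univ_four, hc, hI]
    simp
    ring
  simp_rw [key]
  rw [integral_finsetSum _ fun e _ ↦ (hG4 e).const_mul _]
  simp_rw [integral_const_mul]
  have h4 : ∀ e, ∫ w, (∑ a, c e a * X (I a) w) ^ 4 ∂P =
      3 * (∑ a, ∑ b, c e a * c e b * ∫ w, X (I a) w * X (I b) w ∂P) ^ 2 := by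
    intro e
    rw [integral_pow_four (hG e) (hG0 e), hG2]
  simp_rw [h4]
  have hsymm : ∀ a b, ∫ w, X a w * X b w ∂P = ∫ w, X b w * X a w ∂P := by
    intro a b; simp_rw [mul_comm]
  simp only [Fin.sum_univ_eight, Fin.sum_univ_four, hc, hI]
  simp
  rw [hsymm j i, hsymm k i, hsymm l i, hsymm k j, hsymm l j, hsymm l k]
  ring

end GaussianMoments

/-! ### Moments of the antithetic noise. -/

section AntitheticMoments

open scoped ENNReal

variable {Ω : Type*} [MeasurableSpace Ω] {P : Measure Ω} {n K : ℕ} {σ : ℝ}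
  {ω : Fin K → Ω → EuclideanSpace ℝ (Fin n)}

theorem IsAntithetic.hasGaussianLaw_coord (hω : IsAntithetic σ ω P) :
    HasGaussianLaw (fun w (p : Fin K × Fin n) ↦ ω p.1 w p.2) P :=
  hω.gaussian.map_fun (ContinuousLinearMap.pi fun p : Fin K × Fin n ↦
    (EuclideanSpace.proj p.2 : EuclideanSpace ℝ (Fin n) →L[ℝ] ℝ) ∘L
      (ContinuousLinearMap.proj p.1 : (Fin K → EuclideanSpace ℝ (Fin n)) →L[ℝ] _))

theorem IsAntithetic.memLp_coord (hω : IsAntithetic σ ω P) (k : Fin K) (a : Fin n) {p : ℝ≥0∞}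
    (hp : p ≠ ⊤) : MemLp (fun w ↦ ω k w a) p P :=
  HasGaussianLaw.memLp_eval hω.hasGaussianLaw_coord (k, a) hp

theorem IsAntithetic.integral_coord (hω : IsAntithetic σ ω P) (k : Fin K) (a : Fin n) :
    ∫ w, ω k w a ∂P = 0 := by
  have h := integral_map (hω.hasLaw k).aemeasurable
    (f := fun x : EuclideanSpace ℝ (Fin n) ↦ x a) (by fun_prop)
  rw [← h, (hω.hasLaw k).map_eq]
  have := (EuclideanSpace.proj a : EuclideanSpace ℝ (Fin n) →L[ℝ] ℝ).integral_comp_id_comm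
    (μ := multivariateGaussian 0 (σ ^ 2 • (1 : Matrix (Fin n) (Fin n) ℝ))) IsGaussian.integrable_id
  simpa using this

/-- The common coordinatewise covariance of `ω⁽ʲ⁾` and `ω⁽ᵏ⁾`. -/
noncomputable def antitheticCov (σ : ℝ) {K : ℕ} (j k : Fin K) : ℝ :=
  if j = k then σ ^ 2 else -(σ ^ 2 / ((K : ℝ) - 1))

theorem IsAntithetic.integral_mul_coord (hω : IsAntithetic σ ω P) (j k : Fin K) (a b : Fin n) :
    ∫ w, ω j w a * ω k w b ∂P = antitheticCov σ j k * if a = b then 1 else 0 := by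
  have hPm : IsProbabilityMeasure P := hω.gaussian.isProbabilityMeasure
  have h1 := covariance_eq_sub (hω.memLp_coord j a (p := 2) (by simp))
    (hω.memLp_coord k b (p := 2) (by simp))
  rw [hω.integral_coord, zero_mul, sub_zero] at h1
  simp only [Pi.mul_apply] at h1
  rw [← h1, antitheticCov]
  split_ifs with hjk hab hab
  · subst hjk hab
    have h2 := covariance_eval_multivariateGaussian (μ := (0 : EuclideanSpace ℝ (Fin n)))
      (posSemidef_sq_smul_one σ) a a
    rw [← (hω.hasLaw j).map_eq, covariance_map (by fun_prop) (by fun_prop)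
      (hω.hasLaw j).aemeasurable] at h2
    simpa [Function.comp_def] using h2
  · subst hjk
    have h2 := covariance_eval_multivariateGaussian (μ := (0 : EuclideanSpace ℝ (Fin n)))
      (posSemidef_sq_smul_one σ) a b
    rw [← (hω.hasLaw j).map_eq, covariance_map (by fun_prop) (by fun_prop)
      (hω.hasLaw j).aemeasurable] at h2
    simpa [Function.comp_def, hab] using h2
  · rw [hω.cov j k hjk a b]; simp [hab]
  · rw [hω.cov j k hjk a b]; simp [hab]

theorem sum_antitheticCov (hK : 1 < K) (σ : ℝ) (j : Fin K) : ∑ k, antitheticCov σ j k = 0 := by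
  have hK' : (0 : ℝ) < K - 1 := by
    have : (1 : ℝ) < K := by exact_mod_cast hK
    linarith
  have h1 : ∀ k, antitheticCov σ j k =
      -(σ ^ 2 / ((K : ℝ) - 1)) + if j = k then σ ^ 2 + σ ^ 2 / ((K : ℝ) - 1) else 0 := by
    intro k
    unfold antitheticCov
    split_ifs <;> ring
  simp_rw [h1, Finset.sum_add_distrib]
  simp
  field_simp
  ring

/-- The `K` diagonal terms give `Kσ⁴` and the `K(K-1)` others give `Kσ⁴/(K-1)`. This is the source
of the factor `1/(K-1)` in the limit. -/
theorem sum_antitheticCov_sq (hK : 1 < K) (σ : ℝ) :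
    ∑ j : Fin K, ∑ k, antitheticCov σ j k ^ 2 = K ^ 2 * σ ^ 4 / ((K : ℝ) - 1) := by
  have hK' : (0 : ℝ) < K - 1 := by
    have : (1 : ℝ) < K := by exact_mod_cast hK
    linarith
  have h1 : ∀ j k : Fin K, antitheticCov σ j k ^ 2 =
      (σ ^ 2 / ((K : ℝ) - 1)) ^ 2 + if j = k then σ ^ 4 - (σ ^ 2 / ((K : ℝ) - 1)) ^ 2 else 0 := by
    intro j k
    unfold antitheticCov
    split_ifs <;> ring
  simp_rw [h1, Finset.sum_add_distrib]
  simp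
  field_simp
  ring

/-- Each coordinate of the sum has zero second moment, because every row of the covariance across
copies sums to zero. -/
theorem IsAntithetic.ae_sum_eq_zero (hω : IsAntithetic σ ω P) (hK : 1 < K) :
    ∀ᵐ w ∂P, ∑ k, ω k w = 0 := by
  have hint : ∀ j k a, Integrable (fun w ↦ ω j w a * ω k w a) P := fun j k a ↦
    (hω.memLp_coord j a (p := 2) (by simp)).integrable_mul (hω.memLp_coord k a (p := 2) (by simp))
  have h1 : ∀ a : Fin n, ∀ᵐ w ∂P, ∑ k, ω k w a = 0 := by
    intro a
    have e : (fun w ↦ (∑ k, ω k w a) ^ 2) = fun w ↦ ∑ j, ∑ k, ω j w a * ω k w a := by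
      funext w; rw [sq, Finset.sum_mul_sum]
    have h2 : ∫ w, (∑ k, ω k w a) ^ 2 ∂P = 0 := by
      rw [e, integral_finsetSum _ fun j _ ↦ integrable_finsetSum _ fun k _ ↦ hint j k a]
      refine Finset.sum_eq_zero fun j _ ↦ ?_
      rw [integral_finsetSum _ fun k _ ↦ hint j k a]
      simp_rw [hω.integral_mul_coord, if_true, mul_one]
      exact sum_antitheticCov hK σ j
    have h3 : Integrable (fun w ↦ (∑ k, ω k w a) ^ 2) P := by
      rw [e]
      exact integrable_finsetSum _ fun j _ ↦ integrable_finsetSum _ fun k _ ↦ hint j k a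
    rw [integral_eq_zero_iff_of_nonneg (fun _ ↦ sq_nonneg _) h3] at h2
    filter_upwards [h2] with w hw
    simpa using hw
  filter_upwards [ae_all_iff.2 h1] with w hw
  ext a
  simpa using hw a

/-- The `(a, b)` coefficient of the quadratic form `(2 / K) ∑ₖ ω⁽ᵏ⁾ (ω⁽ᵏ⁾)ᵀ`. -/
noncomputable def noiseCoeff {n K : ℕ} (v : Fin K → EuclideanSpace ℝ (Fin n))
    (p : Fin n × Fin n) : ℝ :=
  2 / K * ∑ k, v k p.1 * v k p.2

theorem IsAntithetic.memLp_mul_coord (hω : IsAntithetic σ ω P) (j k : Fin K) (a b : Fin n) :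
    MemLp (fun w ↦ ω j w a * ω k w b) 2 P :=
  (hω.memLp_coord k b (p := 4) (by simp)).mul (hω.memLp_coord j a (p := 4) (by simp))

theorem IsAntithetic.memLp_noiseCoeff (hω : IsAntithetic σ ω P) (p : Fin n × Fin n) :
    MemLp (fun w ↦ noiseCoeff (fun k ↦ ω k w) p) 2 P :=
  (memLp_finsetSum _ fun k _ ↦ hω.memLp_mul_coord k k p.1 p.2).const_mul _

theorem IsAntithetic.integral_noiseCoeff (hω : IsAntithetic σ ω P) (hK : 1 < K)
    (p : Fin n × Fin n) :
    ∫ w, noiseCoeff (fun k ↦ ω k w) p ∂P = 2 * σ ^ 2 * if p.1 = p.2 then 1 else 0 := by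
  have hPm : IsProbabilityMeasure P := hω.gaussian.isProbabilityMeasure
  have hK' : (K : ℝ) ≠ 0 := by exact_mod_cast (by omega : K ≠ 0)
  unfold noiseCoeff
  rw [integral_const_mul, integral_finsetSum _ fun k _ ↦
    (hω.memLp_mul_coord k k p.1 p.2).integrable one_le_two]
  simp_rw [hω.integral_mul_coord, antitheticCov, if_true]
  simp
  field_simp

theorem IsAntithetic.integral_noiseCoeff_mul (hω : IsAntithetic σ ω P) (hK : 1 < K)
    (p q : Fin n × Fin n) :
    ∫ w, (noiseCoeff (fun k ↦ ω k w) p - ∫ w, noiseCoeff (fun k ↦ ω k w) p ∂P) *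
      (noiseCoeff (fun k ↦ ω k w) q - ∫ w, noiseCoeff (fun k ↦ ω k w) q ∂P) ∂P =
      4 * σ ^ 4 / ((K : ℝ) - 1) * ((if p = q then 1 else 0) + if p = q.swap then 1 else 0) := by
  have hPm : IsProbabilityMeasure P := hω.gaussian.isProbabilityMeasure
  have hK0 : (K : ℝ) ≠ 0 := by exact_mod_cast (by omega : K ≠ 0)
  have hK1 : (K : ℝ) - 1 ≠ 0 := by
    have : (1 : ℝ) < K := by exact_mod_cast hK
    linarith
  obtain ⟨a, b⟩ := p
  obtain ⟨c, d⟩ := q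
  have hcov := covariance_eq_sub (hω.memLp_noiseCoeff (a, b)) (hω.memLp_noiseCoeff (c, d))
  rw [covariance] at hcov
  rw [hcov, hω.integral_noiseCoeff hK, hω.integral_noiseCoeff hK]
  have hint : ∀ j k, Integrable (fun w ↦ ω j w a * ω j w b * (ω k w c * ω k w d)) P := fun j k ↦
    (hω.memLp_mul_coord j j a b).integrable_mul (hω.memLp_mul_coord k k c d)
  -- In Isserlis' formula the pairing within each copy is independent of `j, k` and, after
  -- summation, cancels the product of the means; each of the two cross pairings carries
  -- `antitheticCov σ j k ^ 2`.
  have h4 : ∀ j k, ∫ w, ω j w a * ω j w b * (ω k w c * ω k w d) ∂P =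
      σ ^ 4 * ((if a = b then 1 else 0) * if c = d then 1 else 0) +
      antitheticCov σ j k ^ 2 * ((if a = c then 1 else 0) * (if b = d then 1 else 0) +
        (if a = d then 1 else 0) * if b = c then 1 else 0) := by
    intro j k
    have := HasGaussianLaw.integral_mul_mul_mul hω.hasGaussianLaw_coord
      (fun p ↦ hω.integral_coord p.1 p.2) (j, a) (j, b) (k, c) (k, d)
    simp only [hω.integral_mul_coord] at this
    rw [this]
    have e : ∀ i : Fin K, antitheticCov σ i i = σ ^ 2 := fun i ↦ if_pos rfl
    rw [e, e]
    ring
  have e1 : ∀ w, ((fun w ↦ noiseCoeff (fun k ↦ ω k w) (a, b)) *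
      fun w ↦ noiseCoeff (fun k ↦ ω k w) (c, d)) w =
      (2 / K) ^ 2 * ∑ j, ∑ k, ω j w a * ω j w b * (ω k w c * ω k w d) := by
    intro w
    simp only [Pi.mul_apply, noiseCoeff]
    rw [← Finset.sum_mul_sum]
    ring
  simp_rw [e1]
  rw [integral_const_mul, integral_finsetSum _ fun j _ ↦ integrable_finsetSum _ fun k _ ↦ hint j k]
  simp_rw [integral_finsetSum _ fun k _ ↦ hint _ k, h4, Finset.sum_add_distrib, ← Finset.sum_mul]
  rw [sum_antitheticCov_sq hK]
  simp only [Finset.sum_const, Finset.card_univ, Fintype.card_fin, nsmul_eq_mul, Prod.swap,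
    Prod.mk.injEq]
  have e2 : (if a = c ∧ b = d then (1 : ℝ) else 0) =
      (if a = c then 1 else 0) * (if b = d then 1 else 0) := by
    split_ifs <;> simp_all
  have e3 : (if a = d ∧ b = c then (1 : ℝ) else 0) =
      (if a = d then 1 else 0) * (if b = c then 1 else 0) := by
    split_ifs <;> simp_all
  rw [e2, e3]
  field_simp
  ring

end AntitheticMoments

/-! ### Reducible variance: continuity, invariance and a bilinear formula. -/

section ReducibleVariance

open scoped ENNReal

variable {Ω E : Type*} [MeasurableSpace Ω] [mE : MeasurableSpace E] {P : Measure Ω}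
  {Y : Ω → E}

theorem reducibleVariance_congr_ae {X X' : Ω → ℝ} (h : X =ᵐ[P] X') :
    reducibleVariance X Y P = reducibleVariance X' Y P :=
  integral_congr_ae (condVar_congr_ae h)

theorem tendsto_eLpNorm_of_tendsto_eLpNorm_sub {ι : Type*} {l : Filter ι} {V : ι → Ω → ℝ}
    {V₀ : Ω → ℝ} {p : ℝ≥0∞} (hp : 1 ≤ p) (hV : ∀ᶠ i in l, AEStronglyMeasurable (V i) P)
    (hV₀ : MemLp V₀ p P) (h : Tendsto (fun i ↦ eLpNorm (V i - V₀) p P) l (𝓝 0)) :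
    Tendsto (fun i ↦ eLpNorm (V i) p P) l (𝓝 (eLpNorm V₀ p P)) := by
  have hlo : Tendsto (fun i ↦ eLpNorm V₀ p P - eLpNorm (V i - V₀) p P) l
      (𝓝 (eLpNorm V₀ p P - 0)) := ENNReal.Tendsto.sub tendsto_const_nhds h (Or.inl hV₀.2.ne)
  have hhi : Tendsto (fun i ↦ eLpNorm V₀ p P + eLpNorm (V i - V₀) p P) l
      (𝓝 (eLpNorm V₀ p P + 0)) := tendsto_const_nhds.add h
  rw [tsub_zero] at hlo
  rw [add_zero] at hhi
  refine tendsto_of_tendsto_of_tendsto_of_le_of_le' hlo hhi ?_ ?_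
  · filter_upwards [hV] with i hi
    rw [tsub_le_iff_right]
    have := eLpNorm_sub_le hi (hi.sub hV₀.1) hp
    simpa using this
  · filter_upwards [hV] with i hi
    have := eLpNorm_add_le hV₀.1 (hi.sub hV₀.1) hp
    simpa using this

variable [IsProbabilityMeasure P]

theorem reducibleVariance_eq_eLpNorm (hY : Measurable Y) {X : Ω → ℝ} (hX : MemLp X 2 P) :
    reducibleVariance X Y P = (eLpNorm (X - P[X | mE.comap Y]) 2 P).toReal ^ 2 := by
  have hV : MemLp (X - P[X | mE.comap Y]) 2 P := hX.sub (hX.condExp one_le_two)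
  have h1 : reducibleVariance X Y P = ∫ w, ((X - P[X | mE.comap Y]) w) ^ 2 ∂P :=
    integral_condExp hY.comap_le
  have h2 := hV.eLpNorm_eq_integral_rpow_norm (by simp) (by simp)
  rw [h1, h2, ENNReal.toReal_ofReal (by positivity), ← Real.rpow_natCast, ← Real.rpow_mul
    (by positivity)]
  simp

theorem reducibleVariance_add_of_aestronglyMeasurable (hY : Measurable Y) {T Z : Ω → ℝ}
    (hT : MemLp T 2 P) (hZ : MemLp Z 2 P) (hZm : AEStronglyMeasurable[mE.comap Y] Z P) :
    reducibleVariance (T + Z) Y P = reducibleVariance T Y P := by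
  rw [reducibleVariance_eq_eLpNorm hY (hT.add hZ), reducibleVariance_eq_eLpNorm hY hT]
  congr 2
  refine eLpNorm_congr_ae ?_
  filter_upwards [condExp_add (hT.integrable one_le_two) (hZ.integrable one_le_two) (mE.comap Y),
    condExp_of_aestronglyMeasurable' hY.comap_le hZm (hZ.integrable one_le_two)] with w h1 h2
  simp only [Pi.sub_apply, Pi.add_apply] at h1 ⊢
  rw [h1, h2]
  ring

/-- The map `X ↦ X - E[X | Y]` is linear and bounded on `L²` since conditional expectation is a
contraction, and the reducible variance is the squared norm of its value. -/
theorem tendsto_reducibleVariance (hY : Measurable Y) {ι : Type*} {l : Filter ι}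
    {T : ι → Ω → ℝ} {T₀ : Ω → ℝ} (hT : ∀ᶠ i in l, MemLp (T i) 2 P) (hT₀ : MemLp T₀ 2 P)
    (h : Tendsto (fun i ↦ eLpNorm (T i - T₀) 2 P) l (𝓝 0)) :
    Tendsto (fun i ↦ reducibleVariance (T i) Y P) l (𝓝 (reducibleVariance T₀ Y P)) := by
  have hV₀ : MemLp (T₀ - P[T₀ | mE.comap Y]) 2 P := hT₀.sub (hT₀.condExp one_le_two)
  have h1 : Tendsto (fun i ↦ eLpNorm ((T i - P[T i | mE.comap Y]) - (T₀ - P[T₀ | mE.comap Y])) 2 P)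
      l (𝓝 0) := by
    have h2 := h.add h
    rw [add_zero] at h2
    refine tendsto_of_tendsto_of_tendsto_of_le_of_le' tendsto_const_nhds h2
      (Eventually.of_forall fun _ ↦ zero_le) ?_
    filter_upwards [hT] with i hi
    have e : (T i - P[T i | mE.comap Y]) - (T₀ - P[T₀ | mE.comap Y]) =ᵐ[P]
        (T i - T₀) - P[T i - T₀ | mE.comap Y] := by
      filter_upwards [condExp_sub (hi.integrable one_le_two) (hT₀.integrable one_le_two)
        (mE.comap Y)] with w hw
      simp only [Pi.sub_apply] at hw ⊢
      rw [hw]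
      ring
    rw [eLpNorm_congr_ae e]
    refine (eLpNorm_sub_le (hi.1.sub hT₀.1) ((hi.sub hT₀).condExp one_le_two).1 one_le_two).trans ?_
    gcongr
    exact eLpNorm_condExp_le_eLpNorm _ one_le_two
  have h3 := tendsto_eLpNorm_of_tendsto_eLpNorm_sub one_le_two
    (by filter_upwards [hT] with i hi using (hi.sub (hi.condExp one_le_two)).1) hV₀ h1
  have h4 := ((ENNReal.tendsto_toReal hV₀.2.ne).comp h3).pow 2
  rw [reducibleVariance_eq_eLpNorm hY hT₀]
  refine h4.congr' ?_
  filter_upwards [hT] with i hi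
  rw [reducibleVariance_eq_eLpNorm hY hi]
  rfl

theorem condExp_comp_mul_of_indepFun (hY : Measurable Y) {A : E → ℝ} {W : Ω → ℝ}
    (hA : Measurable A) (hAi : Integrable (fun w ↦ A (Y w)) P) (hW : Integrable W P)
    (hind : IndepFun Y W P) :
    P[fun w ↦ A (Y w) * W w | mE.comap Y] =ᵐ[P] fun w ↦ A (Y w) * ∫ w, W w ∂P := by
  -- A measurable version is needed so that the σ-algebra generated by it is contained in the
  -- ambient one.
  obtain ⟨W', hW'm, hWW'⟩ := hW.1.aemeasurable
  have hind' : IndepFun Y W' P := hind.congr (ae_eq_refl _) hWW'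
  have hW'i : Integrable W' P := hW.congr hWW'
  have hAY : StronglyMeasurable[mE.comap Y] (fun w ↦ A (Y w)) :=
    (hA.comp (comap_measurable Y)).stronglyMeasurable
  have h1 : P[W' | mE.comap Y] =ᵐ[P] fun _ ↦ ∫ w, W' w ∂P := by
    refine condExp_indep_eq hW'm.comap_le hY.comap_le
      (comap_measurable W').stronglyMeasurable hind'.symm
  have hmul : Integrable ((fun w ↦ A (Y w)) * W') P :=
    (hind'.comp hA measurable_id).integrable_mul hAi hW'i
  have h2 := condExp_mul_of_stronglyMeasurable_left hAY hmul hW'i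
  have h3 : P[fun w ↦ A (Y w) * W w | mE.comap Y] =ᵐ[P]
      P[(fun w ↦ A (Y w)) * W' | mE.comap Y] :=
    condExp_congr_ae (by filter_upwards [hWW'] with w hw; simp [hw])
  filter_upwards [h1, h2, h3] with w a1 a2 a3
  rw [a3, a2, Pi.mul_apply, a1, integral_congr_ae hWW']

/-- The reducible variance of a bilinear expression in functions of `Y` and variables independent
of `Y`. -/
theorem reducibleVariance_sum_mul {ι : Type*} [Fintype ι] (hY : Measurable Y) {A : ι → E → ℝ}
    {W : ι → Ω → ℝ} (hA : ∀ i, Measurable (A i)) (hA2 : ∀ i, MemLp (fun w ↦ A i (Y w)) 2 P)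
    (hW : ∀ i, MemLp (W i) 2 P) (hind : IndepFun Y (fun w i ↦ W i w) P) :
    reducibleVariance (fun w ↦ ∑ i, A i (Y w) * W i w) Y P =
      ∑ i, ∑ j, (∫ w, A i (Y w) * A j (Y w) ∂P) *
        ∫ w, (W i w - ∫ w, W i w ∂P) * (W j w - ∫ w, W j w ∂P) ∂P := by
  have hindi : ∀ i, IndepFun Y (W i) P := fun i ↦ hind.comp measurable_id (measurable_pi_apply i)
  have hi1 : ∀ i, Integrable (fun w ↦ A i (Y w) * W i w) P := fun i ↦
    ((hindi i).comp (hA i) measurable_id).integrable_mul ((hA2 i).integrable one_le_two)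
      ((hW i).integrable one_le_two)
  have hce : P[fun w ↦ ∑ i, A i (Y w) * W i w | mE.comap Y] =ᵐ[P]
      fun w ↦ ∑ i, A i (Y w) * ∫ w, W i w ∂P := by
    have e : (fun w ↦ ∑ i, A i (Y w) * W i w) = ∑ i, fun w ↦ A i (Y w) * W i w := by
      funext w; simp
    rw [e]
    refine (condExp_finsetSum (fun i _ ↦ hi1 i) _).trans ?_
    have := ae_all_iff.2 fun i ↦ condExp_comp_mul_of_indepFun hY (hA i)
      ((hA2 i).integrable one_le_two) ((hW i).integrable one_le_two) (hindi i)
    filter_upwards [this] with w hw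
    simp [hw]
  have h1 : reducibleVariance (fun w ↦ ∑ i, A i (Y w) * W i w) Y P =
      ∫ w, (((fun w ↦ ∑ i, A i (Y w) * W i w) - P[fun w ↦ ∑ i, A i (Y w) * W i w | mE.comap Y]) w)
        ^ 2 ∂P := integral_condExp hY.comap_le
  -- The residual is `∑ A i (Y) (W i - E W i)`; in its square every term splits into a function of
  -- `Y` times an independent function of the `W`.
  have h2 : ∀ i j, IndepFun (fun w ↦ A i (Y w) * A j (Y w))
      (fun w ↦ (W i w - ∫ w, W i w ∂P) * (W j w - ∫ w, W j w ∂P)) P := by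
    intro i j
    exact hind.comp ((hA i).mul (hA j))
      (((measurable_pi_apply i).sub_const (∫ w, W i w ∂P)).mul
        ((measurable_pi_apply j).sub_const (∫ w, W j w ∂P)))
  have hAA : ∀ i j, Integrable (fun w ↦ A i (Y w) * A j (Y w)) P := fun i j ↦
    (hA2 i).integrable_mul (hA2 j)
  have hWW : ∀ i j, Integrable (fun w ↦ (W i w - ∫ w, W i w ∂P) * (W j w - ∫ w, W j w ∂P)) P :=
    fun i j ↦ ((hW i).sub (memLp_const _)).integrable_mul ((hW j).sub (memLp_const _))
  have hint : ∀ i j, Integrable (fun w ↦ (A i (Y w) * A j (Y w)) *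
      ((W i w - ∫ w, W i w ∂P) * (W j w - ∫ w, W j w ∂P))) P := fun i j ↦
    (h2 i j).integrable_mul (hAA i j) (hWW i j)
  have h3 : ∫ w, (((fun w ↦ ∑ i, A i (Y w) * W i w) -
      P[fun w ↦ ∑ i, A i (Y w) * W i w | mE.comap Y]) w) ^ 2 ∂P =
      ∫ w, ∑ i, ∑ j, (A i (Y w) * A j (Y w)) *
        ((W i w - ∫ w, W i w ∂P) * (W j w - ∫ w, W j w ∂P)) ∂P := by
    refine integral_congr_ae ?_
    filter_upwards [hce] with w hw
    rw [Pi.sub_apply, hw, ← Finset.sum_sub_distrib, sq, Finset.sum_mul_sum]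
    refine Finset.sum_congr rfl fun i _ ↦ Finset.sum_congr rfl fun j _ ↦ by ring
  rw [h1, h3, integral_finsetSum _ fun i _ ↦ integrable_finsetSum _ fun j _ ↦ hint i j]
  refine Finset.sum_congr rfl fun i _ ↦ ?_
  rw [integral_finsetSum _ fun j _ ↦ hint i j]
  refine Finset.sum_congr rfl fun j _ ↦ ?_
  exact (h2 i j).integral_fun_mul_eq_mul_integral (hAA i j).1 (hWW i j).1

end ReducibleVariance

/-! ### Invariance of the weak Jacobian under almost everywhere changes. -/

section WeakJacobianCongr

variable {n : ℕ} {g g' : EuclideanSpace ℝ (Fin n) → EuclideanSpace ℝ (Fin n)}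
  {G G' : EuclideanSpace ℝ (Fin n) → Matrix (Fin n) (Fin n) ℝ}

theorem quasiMeasurePreserving_add_smul_line (n : ℕ) :
    Measure.QuasiMeasurePreserving
      (fun x : (EuclideanSpace ℝ (Fin n) × EuclideanSpace ℝ (Fin n)) × ℝ ↦ x.1.1 + x.2 • x.1.2)
      ((volume.prod volume).prod (volume.restrict (Set.Ioc (0 : ℝ) 1))) volume := by
  refine QuasiMeasurePreserving.prod_of_left (by fun_prop) (ae_of_all _ fun t ↦ ?_)
  refine QuasiMeasurePreserving.prod_of_left (by fun_prop) (ae_of_all _ fun z ↦ ?_)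
  exact (measurePreserving_add_right volume (t • z)).quasiMeasurePreserving

/-- For fixed `t` and `z` the map `y ↦ y + t z` preserves Lebesgue measure, so by Fubini almost
every segment meets a null set only for a null set of times `t`. -/
theorem HasWeakJacobian.congr (h : HasWeakJacobian g G) (hg : g =ᵐ[volume] g')
    (hG : G =ᵐ[volume] G') : HasWeakJacobian g' G' where
  aemeasurable i j := (h.aemeasurable i j).congr (by filter_upwards [hG] with y hy; rw [hy])
  ae_line_integral i := by
    have h1 : ∀ᵐ p : EuclideanSpace ℝ (Fin n) × EuclideanSpace ℝ (Fin n), g p.1 = g' p.1 :=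
      Measure.quasiMeasurePreserving_fst.ae hg
    have h2 : ∀ᵐ p : EuclideanSpace ℝ (Fin n) × EuclideanSpace ℝ (Fin n),
        g (p.1 + p.2) = g' (p.1 + p.2) := (quasiMeasurePreserving_add volume volume).ae hg
    have h3 := Measure.ae_ae_of_ae_prod ((quasiMeasurePreserving_add_smul_line n).ae hG)
    filter_upwards [h.ae_line_integral i, h1, h2, h3] with p a1 a2 a3 a4
    have e : (fun t : ℝ ↦ ∑ j, p.2 j * G (p.1 + t • p.2) i j) =ᵐ[volume.restrict (Set.uIoc 0 1)]
        fun t ↦ ∑ j, p.2 j * G' (p.1 + t • p.2) i j := by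
      rw [Set.uIoc_of_le zero_le_one]
      filter_upwards [a4] with t ht
      exact Finset.sum_congr rfl fun j _ ↦ congrArg (fun A : Matrix (Fin n) (Fin n) ℝ ↦ p.2 j * A i j) ht
    rw [← a2, ← a3, ← intervalIntegral.integral_congr_ae_restrict e]
    exact ⟨a1.1.congr_ae e, a1.2⟩

end WeakJacobianCongr

/-! ### Integrability and decomposition of the estimator. -/

section CrossValidation

open scoped ENNReal RealInnerProductSpace

variable {Ω : Type*} [MeasurableSpace Ω] {P : Measure Ω} {n K : ℕ} {σ : ℝ}
  {θ : EuclideanSpace ℝ (Fin n)} {Y : Ω → EuclideanSpace ℝ (Fin n)}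
  {ω : Fin K → Ω → EuclideanSpace ℝ (Fin n)}
  {g : EuclideanSpace ℝ (Fin n) → EuclideanSpace ℝ (Fin n)}
  {G : EuclideanSpace ℝ (Fin n) → Fin n → Fin n → ℝ}

theorem memLp_norm_sq_iff_memLp_four {V : Type*} [NormedAddCommGroup V] {u : Ω → V}
    (hu : AEStronglyMeasurable u P) : MemLp (fun w ↦ ‖u w‖ ^ 2) 2 P ↔ MemLp u 4 P := by
  have h := memLp_norm_rpow_iff (p := 4) (q := 2) hu (by simp) (by simp)
  have e : (4 : ℝ≥0∞) / 2 = 2 := by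
    rw [← ENNReal.toReal_eq_toReal_iff' (by finiteness) (by simp), ENNReal.toReal_div]
    norm_num
  rw [e] at h
  simpa using h

theorem memLp_four_of_integrable_norm_pow {V : Type*} [NormedAddCommGroup V] {u : Ω → V}
    (hu : AEStronglyMeasurable u P) (h : Integrable (fun w ↦ ‖u w‖ ^ 4) P) : MemLp u 4 P := by
  rw [← memLp_norm_rpow_iff (p := 4) (q := 4) hu (by simp) (by simp),
    ENNReal.div_self (by simp) (by simp), memLp_one_iff_integrable]
  simpa using h

theorem map_prod_isoGaussian [IsProbabilityMeasure P] (hY : HasLaw Y (isoGaussian σ θ) P)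
    (hω : IsAntithetic σ ω P)
    (hind : IndepFun Y (fun w k ↦ ω k w) P) (k : Fin K) :
    P.map (fun w ↦ (Y w, ω k w)) = (isoGaussian σ θ).prod (isoGaussian σ 0) := by
  have h : IndepFun Y (ω k) P := hind.comp measurable_id (measurable_pi_apply k)
  rw [(indepFun_iff_map_prod_eq_prod_map_map hY.aemeasurable (hω.hasLaw k).aemeasurable).1 h,
    hY.map_eq, (hω.hasLaw k).map_eq]

theorem map_trainData [IsProbabilityMeasure P] (hY : HasLaw Y (isoGaussian σ θ) P)
    (hω : IsAntithetic σ ω P) (hind : IndepFun Y (fun w k ↦ ω k w) P) (k : Fin K) {α : ℝ}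
    (hα : 0 ≤ α) :
    P.map (fun w ↦ trainData α (Y w) (ω k w)) = isoGaussian (σ * √(1 + α)) θ := by
  refine Eq.trans ?_ (map_add_smul_isoGaussian σ hα θ)
  rw [← map_prod_isoGaussian hY hω hind k,
    AEMeasurable.map_map_of_aemeasurable (by fun_prop)
      (hY.aemeasurable.prodMk (hω.hasLaw k).aemeasurable)]
  rfl

theorem memLp_testData [IsProbabilityMeasure P] (hY : HasLaw Y (isoGaussian σ θ) P)
    (hω : IsAntithetic σ ω P) (k : Fin K) (α : ℝ) {p : ℝ≥0∞} (hp : p ≠ ⊤) :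
    MemLp (fun w ↦ testData α (Y w) (ω k w)) p P :=
  (hY.hasGaussianLaw.memLp hp).sub (((hω.hasLaw k).hasGaussianLaw.memLp hp).const_smul (1 / √α))

theorem memLp_comp_trainData_iff [IsProbabilityMeasure P] (hg : Measurable g)
    (hY : HasLaw Y (isoGaussian σ θ) P)
    (hω : IsAntithetic σ ω P) (hind : IndepFun Y (fun w k ↦ ω k w) P) (k : Fin K) {α : ℝ}
    (hα : 0 ≤ α) {p : ℝ≥0∞} :
    MemLp (fun w ↦ g (trainData α (Y w) (ω k w))) p P ↔
      MemLp g p (isoGaussian (σ * √(1 + α)) θ) := by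
  have hm : AEMeasurable (fun w ↦ trainData α (Y w) (ω k w)) P :=
    hY.aemeasurable.add ((hω.hasLaw k).aemeasurable.const_smul (√α))
  rw [← map_trainData hY hω hind k hα, memLp_map_measure_iff hg.aestronglyMeasurable hm]
  rfl

/-- Adding back the Gaussian terms `‖ω⁽ᵏ⁾‖²/α` leaves a sum of nonnegative squares in `L²`, which
dominates each of its summands. -/
theorem memLp_four_residual_of_memLp_cvEstimator [IsProbabilityMeasure P] (hg : Measurable g)
    (hK : 1 < K) (hY : HasLaw Y (isoGaussian σ θ) P) (hω : IsAntithetic σ ω P) {α : ℝ}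
    (h : MemLp (cvEstimator g Y ω α) 2 P) (k : Fin K) :
    MemLp (fun w ↦ testData α (Y w) (ω k w) - g (trainData α (Y w) (ω k w))) 4 P := by
  have hK0 : (K : ℝ) ≠ 0 := by exact_mod_cast (by omega : K ≠ 0)
  have hum : ∀ k, AEStronglyMeasurable
      (fun w ↦ testData α (Y w) (ω k w) - g (trainData α (Y w) (ω k w))) P := fun k ↦
    ((memLp_testData hY hω k α (p := 1) (by simp)).1.aemeasurable.sub
      (hg.comp_aemeasurable
        (hY.aemeasurable.add ((hω.hasLaw k).aemeasurable.const_smul (√α))))).aestronglyMeasurable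
  rw [← memLp_norm_sq_iff_memLp_four (hum k)]
  have hω2 : ∀ k, MemLp (fun w ↦ 1 / α * ‖ω k w‖ ^ 2) 2 P := fun k ↦
    ((memLp_norm_sq_iff_memLp_four (hω.hasLaw k).aemeasurable.aestronglyMeasurable).2
      ((hω.hasLaw k).hasGaussianLaw.memLp (by simp))).const_mul _
  have hsum : MemLp (fun w ↦ ∑ k, ‖testData α (Y w) (ω k w) - g (trainData α (Y w) (ω k w))‖ ^ 2)
      2 P := by
    have := (h.const_mul (K : ℝ)).add (memLp_finsetSum Finset.univ fun k _ ↦ hω2 k)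
    refine this.congr_norm ?_ (ae_of_all _ fun w ↦ ?_)
    · exact Finset.aestronglyMeasurable_fun_sum _ fun k _ ↦ (hum k).norm.pow 2
    · simp only [Pi.add_apply, cvEstimator]
      congr 1
      rw [← mul_assoc, mul_one_div_cancel hK0, one_mul, Finset.sum_sub_distrib]
      ring
  refine hsum.mono ((hum k).norm.pow 2) (ae_of_all _ fun w ↦ ?_)
  rw [Real.norm_of_nonneg (by positivity), Real.norm_of_nonneg (by positivity)]
  exact Finset.single_le_sum
    (f := fun k ↦ ‖testData α (Y w) (ω k w) - g (trainData α (Y w) (ω k w))‖ ^ 2)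
    (fun _ _ ↦ by positivity) (Finset.mem_univ k)

theorem memLp_cvEstimator [IsProbabilityMeasure P] (hg : Measurable g)
    (hY : HasLaw Y (isoGaussian σ θ) P) (hω : IsAntithetic σ ω P)
    (hind : IndepFun Y (fun w k ↦ ω k w) P) {α : ℝ} (hα : 0 ≤ α)
    (hg4 : MemLp g 4 (isoGaussian (σ * √(1 + α)) θ)) : MemLp (cvEstimator g Y ω α) 2 P := by
  have hk : ∀ k, MemLp (fun w ↦ ‖testData α (Y w) (ω k w) - g (trainData α (Y w) (ω k w))‖ ^ 2
      - 1 / α * ‖ω k w‖ ^ 2) 2 P := by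
    intro k
    have hu : MemLp (fun w ↦ testData α (Y w) (ω k w) - g (trainData α (Y w) (ω k w))) 4 P :=
      (memLp_testData hY hω k α (by simp)).sub
        ((memLp_comp_trainData_iff hg hY hω hind k hα).2 hg4)
    exact ((memLp_norm_sq_iff_memLp_four hu.1).2 hu).sub
      (((memLp_norm_sq_iff_memLp_four (hω.hasLaw k).aemeasurable.aestronglyMeasurable).2
        ((hω.hasLaw k).hasGaussianLaw.memLp (by simp))).const_mul _)
  exact (memLp_finsetSum Finset.univ fun k _ ↦ hk k).const_mul _

theorem cvEstimator_ae_eq (hω : IsAntithetic σ ω P) (hK : 1 < K) {α : ℝ} (hα : 0 < α) :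
    cvEstimator g Y ω α =ᵐ[P]
      (fun w ↦ 1 / (K : ℝ) * ∑ k, cvIncrement g α (Y w, ω k w)) + fun w ↦ ‖Y w - g (Y w)‖ ^ 2 := by
  have hK0 : (K : ℝ) ≠ 0 := by exact_mod_cast (by omega : K ≠ 0)
  filter_upwards [hω.ae_sum_eq_zero hK] with w hw
  have hα2 : (1 / √α) ^ 2 = 1 / α := by rw [div_pow, one_pow, Real.sq_sqrt hα.le]
  -- The last inner product is linear in the noise with a coefficient independent of `k`, so it
  -- vanishes in the sum.
  have h1 : ∀ k, ‖testData α (Y w) (ω k w) - g (trainData α (Y w) (ω k w))‖ ^ 2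
      - 1 / α * ‖ω k w‖ ^ 2 = cvIncrement g α (Y w, ω k w) + ‖Y w - g (Y w)‖ ^ 2 +
        ⟪ω k w, (2 * (1 / √α)) • (g (Y w) - Y w)⟫ := by
    intro k
    simp only [cvIncrement, testData, trainData, ← hα2]
    generalize g (Y w + √α • ω k w) = u
    generalize 1 / √α = c
    simp only [norm_sub_sq_real, norm_smul, mul_pow, Real.norm_eq_abs, sq_abs, inner_sub_left,
      inner_sub_right, inner_smul_left, inner_smul_right, real_inner_comm (Y w) (ω k w)]
    simp
    ring
  simp only [cvEstimator, Pi.add_apply]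
  simp_rw [h1, Finset.sum_add_distrib]
  rw [← sum_inner, hw, inner_zero_left]
  simp
  field_simp

end CrossValidation

/-! ### Passage to the limit and removal of Borel measurability. -/

section CrossValidationLimit

open scoped ENNReal RealInnerProductSpace

variable {Ω : Type*} [MeasurableSpace Ω] {P : Measure Ω} {n K : ℕ} {σ : ℝ}
  {θ : EuclideanSpace ℝ (Fin n)} {Y : Ω → EuclideanSpace ℝ (Fin n)}
  {ω : Fin K → Ω → EuclideanSpace ℝ (Fin n)}
  {g : EuclideanSpace ℝ (Fin n) → EuclideanSpace ℝ (Fin n)}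
  {G : EuclideanSpace ℝ (Fin n) → Fin n → Fin n → ℝ}

theorem sum_quadForm_eq_sum_noiseCoeff (A : Fin n → Fin n → ℝ)
    (v : Fin K → EuclideanSpace ℝ (Fin n)) :
    1 / (K : ℝ) * ∑ k, 2 * quadForm A (v k) =
      ∑ p : Fin n × Fin n, A p.1 p.2 * noiseCoeff v p := by
  simp only [quadForm, noiseCoeff, Finset.mul_sum, Fintype.sum_prod_type]
  rw [Finset.sum_comm]
  refine Finset.sum_congr rfl fun i _ ↦ ?_
  rw [Finset.sum_comm]
  refine Finset.sum_congr rfl fun j _ ↦ Finset.sum_congr rfl fun k _ ↦ by ring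

theorem reducibleVariance_limit_eq [IsProbabilityMeasure P] (hK : 1 < K) (hYm : Measurable Y)
    (hω : IsAntithetic σ ω P) (hind : IndepFun Y (fun w k ↦ ω k w) P) (hGm : Measurable G)
    (hG2 : ∀ i j, MemLp (fun w ↦ G (Y w) i j) 2 P) :
    reducibleVariance (fun w ↦ ∑ p : Fin n × Fin n, G (Y w) p.1 p.2 *
        noiseCoeff (fun k ↦ ω k w) p) Y P =
      4 * σ ^ 4 / ((K : ℝ) - 1) * ∫ w, (∑ i, ∑ j, G (Y w) i j ^ 2 +
        ∑ i, ∑ j, G (Y w) i j * G (Y w) j i) ∂P := by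
  have hnm : Measurable (fun (v : Fin K → EuclideanSpace ℝ (Fin n)) (p : Fin n × Fin n) ↦
      noiseCoeff v p) := by
    unfold noiseCoeff; fun_prop
  have hind' : IndepFun Y (fun w p ↦ noiseCoeff (fun k ↦ ω k w) p) P := hind.comp measurable_id hnm
  have h := reducibleVariance_sum_mul hYm (A := fun (p : Fin n × Fin n) y ↦ G y p.1 p.2)
    (W := fun p w ↦ noiseCoeff (fun k ↦ ω k w) p) (fun p ↦ by fun_prop) (fun p ↦ hG2 p.1 p.2)
    (fun p ↦ hω.memLp_noiseCoeff p) hind'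
  rw [h]
  simp_rw [hω.integral_noiseCoeff_mul hK]
  have hint : ∀ i j k l, Integrable (fun w ↦ G (Y w) i j * G (Y w) k l) P := fun i j k l ↦
    (hG2 i j).integrable_mul (hG2 k l)
  simp_rw [sq]
  rw [integral_add (integrable_finsetSum _ fun i _ ↦ integrable_finsetSum _ fun j _ ↦ hint _ _ _ _)
    (integrable_finsetSum _ fun i _ ↦ integrable_finsetSum _ fun j _ ↦ hint _ _ _ _),
    integral_finsetSum _ fun i _ ↦ integrable_finsetSum _ fun j _ ↦ hint _ _ _ _,
    integral_finsetSum _ fun i _ ↦ integrable_finsetSum _ fun j _ ↦ hint _ _ _ _]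
  simp_rw [integral_finsetSum _ fun j _ ↦ hint _ _ _ _]
  rw [← Finset.sum_add_distrib, Finset.mul_sum, Fintype.sum_prod_type]
  refine Finset.sum_congr rfl fun i _ ↦ ?_
  rw [← Finset.sum_add_distrib, Finset.mul_sum]
  refine Finset.sum_congr rfl fun j _ ↦ ?_
  have e : ∀ q : Fin n × Fin n, ((i, j) = q.swap) = (q = (j, i)) := by
    rintro ⟨a, b⟩
    simp only [Prod.swap, Prod.mk.injEq, eq_iff_iff]
    constructor <;> (rintro ⟨rfl, rfl⟩; exact ⟨rfl, rfl⟩)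
  -- The covariance of `W` is supported on equal or transposed index pairs: the former give the
  -- squares of the entries, the latter the trace of the squared matrix.
  simp_rw [e, mul_add, Finset.sum_add_distrib, mul_ite, mul_one, mul_zero]
  simp
  ring

/-- By the triangle inequality only the law of each pair `(Y, ω⁽ᵏ⁾)` matters, and it is the same
product Gaussian for every `k`. -/
theorem tendsto_eLpNorm_sum_cvIncrement [IsProbabilityMeasure P] (hσ : 0 < σ)
    (hY : HasLaw Y (isoGaussian σ θ) P) (hω : IsAntithetic σ ω P)
    (hind : IndepFun Y (fun w k ↦ ω k w) P) (hg : Measurable g) (hGm : Measurable G)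
    (hG : HasWeakJacobian g G) (hG2 : MemLp G 2 (isoGaussian σ θ)) {α₀ : ℝ} (hα₀ : 0 < α₀)
    (hg4 : MemLp g 4 (isoGaussian (σ * √(1 + α₀)) θ)) (hg4' : MemLp g 4 (isoGaussian σ θ)) :
    Tendsto (fun α ↦ eLpNorm ((fun w ↦ 1 / (K : ℝ) * ∑ k, cvIncrement g α (Y w, ω k w)) -
        fun w ↦ 1 / (K : ℝ) * ∑ k, 2 * quadForm (G (Y w)) (ω k w)) 2 P) (𝓝[>] 0) (𝓝 0) := by
  have hm : ∀ α, Measurable (fun q : EuclideanSpace ℝ (Fin n) × EuclideanSpace ℝ (Fin n) ↦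
      cvIncrement g α q - 2 * quadForm (G q.1) q.2) := by
    intro α
    have h1 : Measurable (fun q : EuclideanSpace ℝ (Fin n) × EuclideanSpace ℝ (Fin n) ↦
      g (q.1 + √α • q.2)) := hg.comp (by fun_prop)
    have h2 : Measurable (fun q : EuclideanSpace ℝ (Fin n) × EuclideanSpace ℝ (Fin n) ↦
      g q.1) := hg.comp measurable_fst
    have h3 : Measurable (fun q : EuclideanSpace ℝ (Fin n) × EuclideanSpace ℝ (Fin n) ↦
        quadForm (G q.1) q.2) := by
      unfold quadForm; fun_prop
    have h4 := (measurable_fst (α := EuclideanSpace ℝ (Fin n))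
      (β := EuclideanSpace ℝ (Fin n))).inner (𝕜 := ℝ) (h1.sub h2)
    have h5 := (measurable_snd (α := EuclideanSpace ℝ (Fin n))
      (β := EuclideanSpace ℝ (Fin n))).inner (𝕜 := ℝ) (h1.sub h2)
    exact ((((h1.norm.pow_const 2).sub (h2.norm.pow_const 2)).sub (h4.const_mul 2)).add
      ((h5.const_mul _).const_mul 2)).sub (h3.const_mul 2)
  have hpair : ∀ k, AEMeasurable (fun w ↦ (Y w, ω k w)) P := fun k ↦
    hY.aemeasurable.prodMk (hω.hasLaw k).aemeasurable
  have h1 := tendsto_eLpNorm_cvIncrement hσ θ hα₀ hg hGm hG hG2 hg4 hg4'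
  have h2 := ENNReal.Tendsto.const_mul (a := ‖1 / (K : ℝ)‖ₑ)
    (tendsto_finsetSum (Finset.univ : Finset (Fin K)) fun _ _ ↦ h1) (Or.inr (by simp))
  simp only [Finset.sum_const_zero, mul_zero] at h2
  refine tendsto_of_tendsto_of_tendsto_of_le_of_le' tendsto_const_nhds h2
    (Eventually.of_forall fun _ ↦ zero_le) (Eventually.of_forall fun α ↦ ?_)
  have e : ((fun w ↦ 1 / (K : ℝ) * ∑ k, cvIncrement g α (Y w, ω k w)) -
        fun w ↦ 1 / (K : ℝ) * ∑ k, 2 * quadForm (G (Y w)) (ω k w)) =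
      (1 / (K : ℝ)) • ∑ k, fun w ↦ cvIncrement g α (Y w, ω k w) -
        2 * quadForm (G (Y w)) (ω k w) := by
    funext w
    simp [mul_sub]
  have hmk : ∀ k, AEStronglyMeasurable (fun w ↦ cvIncrement g α (Y w, ω k w) -
      2 * quadForm (G (Y w)) (ω k w)) P := fun k ↦
    ((hm α).comp_aemeasurable (hpair k)).aestronglyMeasurable
  rw [e]
  refine (eLpNorm_const_smul_le (c := 1 / (K : ℝ))).trans ?_
  gcongr
  refine (eLpNorm_sum_le (fun k _ ↦ hmk k) one_le_two).trans ?_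
  gcongr with k
  rw [← map_prod_isoGaussian hY hω hind k,
    eLpNorm_map_measure (hm α).aestronglyMeasurable (hpair k)]
  rfl

theorem cv_reducibleVariance_limit_of_measurable [IsProbabilityMeasure P] (hK : 1 < K)
    (hσ : 0 < σ) (hYm : Measurable Y)
    (hY : HasLaw Y (isoGaussian σ θ) P) (hω : IsAntithetic σ ω P)
    (hind : IndepFun Y (fun w k ↦ ω k w) P) (hg : Measurable g) (hGm : Measurable G)
    (hG : HasWeakJacobian g G) (hg4 : Integrable (fun w ↦ ‖g (Y w)‖ ^ 4) P)
    (hG2 : Integrable (fun w ↦ ∑ i, ∑ j, G (Y w) i j ^ 2) P)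
    (hCV : ∃ α₀ > 0, MemLp (cvEstimator g Y ω α₀) 2 P) :
    (∀ᶠ α in 𝓝[>] (0 : ℝ), MemLp (cvEstimator g Y ω α) 2 P) ∧
    Tendsto (fun α ↦ reducibleVariance (cvEstimator g Y ω α) Y P) (𝓝[>] 0)
      (𝓝 (4 * σ ^ 4 / ((K : ℝ) - 1) * ∫ w, (∑ i, ∑ j, G (Y w) i j ^ 2 +
        ∑ i, ∑ j, G (Y w) i j * G (Y w) j i) ∂P)) := by
  obtain ⟨α₀, hα₀, hCV⟩ := hCV
  have hk₀ : Fin K := ⟨0, by omega⟩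
  have hGij : ∀ i j, Measurable fun y ↦ G y i j := fun i j ↦ by fun_prop
  have hgY4 : MemLp (fun w ↦ g (Y w)) 4 P :=
    memLp_four_of_integrable_norm_pow (hg.comp hYm).aestronglyMeasurable hg4
  have hGY2 : ∀ i j, MemLp (fun w ↦ G (Y w) i j) 2 P := by
    intro i j
    have hm : AEStronglyMeasurable (fun w ↦ G (Y w) i j) P :=
      ((hGij i j).comp hYm).aestronglyMeasurable
    rw [memLp_two_iff_integrable_sq hm]
    refine hG2.mono (hm.pow 2) (ae_of_all _ fun w ↦ ?_)
    rw [Real.norm_of_nonneg (by positivity), Real.norm_of_nonneg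
      (Finset.sum_nonneg fun _ _ ↦ Finset.sum_nonneg fun _ _ ↦ sq_nonneg _)]
    exact (Finset.single_le_sum (f := fun j ↦ G (Y w) i j ^ 2) (fun _ _ ↦ sq_nonneg _)
      (Finset.mem_univ j)).trans (Finset.single_le_sum (f := fun i ↦ ∑ j, G (Y w) i j ^ 2)
      (fun _ _ ↦ Finset.sum_nonneg fun _ _ ↦ sq_nonneg _) (Finset.mem_univ i))
  have hg4' : MemLp g 4 (isoGaussian σ θ) := by
    rw [← hY.map_eq, memLp_map_measure_iff hg.aestronglyMeasurable hY.aemeasurable]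
    exact hgY4
  have hG2' : MemLp G 2 (isoGaussian σ θ) := by
    rw [← hY.map_eq, memLp_map_measure_iff hGm.aestronglyMeasurable hY.aemeasurable]
    exact MemLp.of_eval fun i ↦ MemLp.of_eval fun j ↦ hGY2 i j
  -- Here the hypothesis at `α₀` enters: `g` at the training copy is the Gaussian test copy minus an
  -- `L⁴` residual, and the training copy has the wider law. One index `k` is enough.
  have hg4₀ : MemLp g 4 (isoGaussian (σ * √(1 + α₀)) θ) := by
    rw [← memLp_comp_trainData_iff hg hY hω hind hk₀ hα₀.le]
    have := (memLp_testData hY hω hk₀ α₀ (p := 4) (by simp)).sub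
      (memLp_four_residual_of_memLp_cvEstimator hg hK hY hω hCV hk₀)
    refine this.ae_eq (ae_of_all _ fun w ↦ ?_)
    simp
  obtain ⟨C, hC, hle⟩ := map_add_smul_isoGaussian_le hσ hα₀ θ
  have hCV2 : ∀ α, 0 < α → α ≤ α₀ → MemLp (cvEstimator g Y ω α) 2 P := by
    intro α h0 h1
    refine memLp_cvEstimator hg hY hω hind h0.le ?_
    have := hle α h0.le h1
    rw [map_add_smul_isoGaussian σ h0.le] at this
    exact MemLp.of_measure_le_smul hC this hg4₀
  have hev : ∀ᶠ α in 𝓝[>] (0 : ℝ), 0 < α ∧ α ≤ α₀ := Ioc_mem_nhdsGT hα₀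
  refine ⟨by filter_upwards [hev] with α hα using hCV2 α hα.1 hα.2, ?_⟩
  set Z : Ω → ℝ := fun w ↦ ‖Y w - g (Y w)‖ ^ 2 with hZ
  have hZ2 : MemLp Z 2 P := by
    have h4 : MemLp (fun w ↦ Y w - g (Y w)) 4 P := (hY.hasGaussianLaw.memLp (by simp)).sub hgY4
    exact (memLp_norm_sq_iff_memLp_four h4.1).2 h4
  have hZm : AEStronglyMeasurable[MeasurableSpace.comap Y inferInstance] Z P := by
    have : Measurable fun y ↦ ‖y - g y‖ ^ 2 := (measurable_id.sub hg).norm.pow_const 2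
    exact (this.comp (comap_measurable Y)).stronglyMeasurable.aestronglyMeasurable
  have hT : ∀ α, 0 < α → α ≤ α₀ →
      MemLp (fun w ↦ 1 / (K : ℝ) * ∑ k, cvIncrement g α (Y w, ω k w)) 2 P := by
    intro α h0 h1
    refine ((hCV2 α h0 h1).sub hZ2).ae_eq ?_
    filter_upwards [cvEstimator_ae_eq (g := g) (Y := Y) hω hK h0] with w hw
    rw [Pi.sub_apply, hw, Pi.add_apply, hZ, add_sub_cancel_right]
  have hT₀ : MemLp (fun w ↦ 1 / (K : ℝ) * ∑ k, 2 * quadForm (G (Y w)) (ω k w)) 2 P := by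
    have hq := memLp_quadForm (θ := θ) (σ := σ) hGm hG2'
    have hk : ∀ k, MemLp (fun w ↦ 2 * quadForm (G (Y w)) (ω k w)) 2 P := by
      intro k
      have hq' := hq
      rw [← map_prod_isoGaussian hY hω hind k] at hq'
      exact (hq'.comp_of_map (hY.aemeasurable.prodMk (hω.hasLaw k).aemeasurable)).const_mul 2
    exact (memLp_finsetSum Finset.univ fun k _ ↦ hk k).const_mul _
  have hlim := tendsto_reducibleVariance hYm
    (by filter_upwards [hev] with α hα using hT α hα.1 hα.2) hT₀
    (tendsto_eLpNorm_sum_cvIncrement (K := K) hσ hY hω hind hg hGm hG hG2' hα₀ hg4₀ hg4')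
  simp_rw [sum_quadForm_eq_sum_noiseCoeff] at hlim
  rw [reducibleVariance_limit_eq hK hYm hω hind hGm hGY2] at hlim
  refine hlim.congr' ?_
  filter_upwards [hev] with α hα
  rw [reducibleVariance_congr_ae (cvEstimator_ae_eq (g := g) (Y := Y) hω hK hα.1),
    reducibleVariance_add_of_aestronglyMeasurable hYm (hT α hα.1 hα.2) hZ2 hZm]

end CrossValidationLimit

/-- The laws of `Y` and of every training copy are absolutely continuous, so Borel versions of `g`
and `G` change the random variables involved only on null sets; this reduces to
`cv_reducibleVariance_limit_of_measurable`. -/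
theorem mainTheorem2 {Ω : Type*} [MeasurableSpace Ω] (P : Measure Ω) [IsProbabilityMeasure P]
    {n K : ℕ} (hK : 1 < K) (σ : ℝ) (hσ : 0 < σ) (θ : EuclideanSpace ℝ (Fin n))
    (Y : Ω → EuclideanSpace ℝ (Fin n)) (hYm : Measurable Y)
    (hY : HasLaw Y (multivariateGaussian θ (σ ^ 2 • (1 : Matrix (Fin n) (Fin n) ℝ))) P)
    (ω : Fin K → Ω → EuclideanSpace ℝ (Fin n)) (hω : IsAntithetic σ ω P)
    (hind : IndepFun Y (fun w k ↦ ω k w) P)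
    (g : EuclideanSpace ℝ (Fin n) → EuclideanSpace ℝ (Fin n)) (hg : AEMeasurable g volume)
    (G : EuclideanSpace ℝ (Fin n) → Matrix (Fin n) (Fin n) ℝ) (hG : HasWeakJacobian g G)
    (hg4 : Integrable (fun w ↦ ‖g (Y w)‖ ^ 4) P)
    (hG2 : Integrable (fun w ↦ frobeniusSq (G (Y w))) P)
    (hCV : ∃ α₀ > 0, MemLp (cvEstimator g Y ω α₀) 2 P) :
    (∀ᶠ α in 𝓝[>] (0 : ℝ), MemLp (cvEstimator g Y ω α) 2 P) ∧
    Tendsto (fun α ↦ reducibleVariance (cvEstimator g Y ω α) Y P) (𝓝[>] 0)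
      (𝓝 (4 * σ ^ 4 / ((K : ℝ) - 1) *
        ∫ w, (frobeniusSq (G (Y w)) + (G (Y w) ^ 2).trace) ∂P)) ∧
    ∃ C : ℝ, ∀ᶠ α in 𝓝[>] (0 : ℝ), reducibleVariance (cvEstimator g Y ω α) Y P ≤ C := by
  obtain ⟨g', hg'm, hgg'⟩ := hg
  have hGae : AEMeasurable (fun y i j ↦ G y i j) volume :=
    aemeasurable_pi_lambda _ fun i ↦ aemeasurable_pi_lambda _ fun j ↦ hG.aemeasurable i j
  obtain ⟨G', hG'm, hGG'⟩ := hGae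
  have hGG : G =ᵐ[volume] (fun y ↦ Matrix.of (G' y)) := hGG'
  have hG' : HasWeakJacobian g' G' := hG.congr hgg' hGG
  have hYae : ∀ {p : EuclideanSpace ℝ (Fin n) → Prop}, (∀ᵐ y, p y) → ∀ᵐ w ∂P, p (Y w) := by
    intro p hp
    have h1 := (isoGaussian_absolutelyContinuous hσ θ).ae_le hp
    rw [← hY.map_eq] at h1
    exact ae_of_ae_map hY.aemeasurable h1
  have hCVae : ∀ α, 0 < α → cvEstimator g Y ω α =ᵐ[P] cvEstimator g' Y ω α := by
    intro α hα
    have h1 : ∀ k, ∀ᵐ w ∂P, g (trainData α (Y w) (ω k w)) = g' (trainData α (Y w) (ω k w)) := by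
      intro k
      have h2 : ∀ᵐ y ∂(isoGaussian (σ * √(1 + α)) θ), g y = g' y :=
        (isoGaussian_absolutelyContinuous (s := σ * √(1 + α)) (by positivity) θ).ae_le hgg'
      rw [← map_trainData hY hω hind k hα.le] at h2
      exact ae_of_ae_map
        (hY.aemeasurable.add ((hω.hasLaw k).aemeasurable.const_smul (√α))) h2
    filter_upwards [ae_all_iff.2 h1] with w hw
    simp only [cvEstimator, hw]
  have hpos : ∀ᶠ α in 𝓝[>] (0 : ℝ), 0 < α := self_mem_nhdsWithin
  obtain ⟨α₀, hα₀, hCV₀⟩ := hCV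
  obtain ⟨h1, h2⟩ := cv_reducibleVariance_limit_of_measurable hK hσ hYm hY hω hind hg'm hG'm hG'
    (hg4.congr (by filter_upwards [hYae hgg'] with w hw; rw [hw]))
    (hG2.congr (by filter_upwards [hYae hGG] with w hw; rw [hw]; rfl))
    ⟨α₀, hα₀, hCV₀.ae_eq (hCVae α₀ hα₀)⟩
  have hlim : Tendsto (fun α ↦ reducibleVariance (cvEstimator g Y ω α) Y P) (𝓝[>] 0)
      (𝓝 (4 * σ ^ 4 / ((K : ℝ) - 1) *
        ∫ w, (frobeniusSq (G (Y w)) + (G (Y w) ^ 2).trace) ∂P)) := by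
    have e : ∫ w, (frobeniusSq (G (Y w)) + (G (Y w) ^ 2).trace) ∂P =
        ∫ w, (∑ i, ∑ j, G' (Y w) i j ^ 2 + ∑ i, ∑ j, G' (Y w) i j * G' (Y w) j i) ∂P := by
      refine integral_congr_ae ?_
      filter_upwards [hYae hGG] with w hw
      rw [hw]
      simp [frobeniusSq, sq, Matrix.trace, Matrix.mul_apply]
    rw [e]
    refine h2.congr' ?_
    filter_upwards [hpos] with α hα
    exact (reducibleVariance_congr_ae (hCVae α hα)).symm
  refine ⟨?_, hlim, ?_⟩
  · filter_upwards [h1, hpos] with α a1 a2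
    exact a1.ae_eq (hCVae α a2).symm
  · refine ⟨_, (hlim.eventually (gt_mem_nhds (lt_add_one _))).mono fun α hα ↦ hα.le⟩
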